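/- Let $K$ be a field, let $n\ge m\ge 1$ with $n\ge 2$, and let $\lambda=(\lambda_1\ge\lambda_2\ge\cdots\ge\lambda_m)$ be a partition with $\lambda_1=n$ and $\lambda_m>m-1$. Let $R=K[x_1,\dots,x_n]$ with the standard grading. Let $I=\overline{I}_{\lambda-\mu}\subseteq R$, where $\mu=(0,1,\dots,m-1)$, be the image under $x_i\mapsto x_i$, $y_j\mapsto x_j$ of the generalized Ferrers ideal $I_{\lambda-\mu}=(x_iy_j : 1\le i\le m,\ \mu_i<j\le\lambda_i)$ of $K[x_1,\dots,x_m,y_1,\dots,y_n]$; thus $I=(x_ix_j : 1\le i\le m,\ i\le j\le\lambda_i)$ is a strongly stable ideal generated in degree two. Let $\widehat I$ be the LCM-dual of $I$, that is, the ideal of $R$ generated by the monomials $m_I/f$, where $f$ runs over the minimal monomial generators of $I$ and $m_I$ is their least common multiple. Let $\beta_i$ be the $i$-th (total) Betti number of $R/\widehat I$, i.e. the rank of the $i$-th free module in a minimal graded free resolution of $R/\widehat I$ over $R$. Then $$\beta_1=\lambda_1+\cdots+\lambda_m-\binom m2,$$ $$\beta_2=\lambda_1+2(\lambda_2+\cdots+\lambda_m)-m^2,$$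 $$\beta_3=\lambda_2+\cdots+\lambda_m-\binom{m+1}2+1.$$ Equivalently, with $\mu(I)$ the minimal number of generators of $I$ and $g$ the height of $I$, $$\beta_1=\mu(I),\qquad \beta_2=2\mu(I)-g-n,\qquad \beta_3=\mu(I)-g-n+1.$$ -/

import Mathlib

open MvPolynomial

noncomputable section

namespace LcmDual

/-! ### Monomial ideals and their LCM-duals -/

section Dual

variable {σ : Type*} {K : Type*} [Field K]

/-- The exponent vectors of the minimal monomial generators of an ideal `I`: the monomials of `I`
that are minimal with respect to divisibility. -/
def minExponents (I : Ideal (MvPolynomial σ K)) : Set (σ →₀ ℕ) :=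
  {u | Minimal (fun v : σ →₀ ℕ => monomial v (1 : K) ∈ I) u}

theorem minExponents_finite [Finite σ] (I : Ideal (MvPolynomial σ K)) :
    (minExponents I).Finite := by
  exact (setOfPred_minimal_antichain _).finite_of_wellQuasiOrdered wellQuasiOrdered_le

/-- The exponent vector of `m_I`, the least common multiple of the minimal monomial generators
of `I`. -/
def lcmExponent [Finite σ] (I : Ideal (MvPolynomial σ K)) : σ →₀ ℕ :=
  (minExponents_finite I).toFinset.sup id

/-- The LCM-dual of a monomial ideal `I`: the ideal generated by the monomials `m_I / f`, where `f`
runs over the minimal monomial generators of `I`. -/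
def lcmDual [Finite σ] (I : Ideal (MvPolynomial σ K)) : Ideal (MvPolynomial σ K) :=
  Ideal.span ((fun u => monomial (lcmExponent I - u) (1 : K)) '' minExponents I)

end Dual

/-! ### Generalized Ferrers ideals and their specializations -/

section Ferrers

variable (K : Type*) [Field K] {m : ℕ} (n : ℕ)

/-- The generalized Ferrers ideal `I_{λ-μ} = (x_i y_j : 1 ≤ i ≤ m, μ_i < j ≤ λ_i)` of
`K[x_1, …, x_m, y_1, …, y_n]`. The index `j : Fin n` stands for the variable `y_{j+1}`. -/
def genFerrersIdeal (lam mu : Fin m → ℕ) : Ideal (MvPolynomial (Fin m ⊕ Fin n) K) :=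
  Ideal.span {p | ∃ (i : Fin m) (j : Fin n), mu i < (j : ℕ) + 1 ∧ (j : ℕ) + 1 ≤ lam i ∧
    p = X (Sum.inl i) * X (Sum.inr j)}

variable {K n}

/-- The specialization map `K[x_1, …, x_m, y_1, …, y_n] → K[x_1, …, x_n]` for `m ≤ n`, given by
`x_i ↦ x_i` and `y_j ↦ x_j`. -/
def specializationMap (hmn : m ≤ n) :
    MvPolynomial (Fin m ⊕ Fin n) K →ₐ[K] MvPolynomial (Fin n) K :=
  rename (Sum.elim (Fin.castLE hmn) id)

variable (K)

/-- The specialization in `K[x_1, …, x_n]` of the generalized Ferrers ideal `I_{λ-μ}` with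
`μ = (0, 1, …, m - 1)`. -/
def stronglyStableIdeal (hmn : m ≤ n) (lam : Fin m → ℕ) : Ideal (MvPolynomial (Fin n) K) :=
  (genFerrersIdeal K n lam (fun i => (i : ℕ))).map (specializationMap hmn)

end Ferrers

/-! ### Minimal graded free resolutions and Betti numbers -/

section Resolution

variable {σ : Type*} {K : Type*} [Field K]

/-- All monomials of `p` have degree `d` (so `p = 0` if `d < 0`). -/
def HomogeneousOfDegree (p : MvPolynomial σ K) (d : ℤ) : Prop :=
  ∀ u ∈ p.support, (u.degree : ℤ) = d

/-- A minimal graded free resolution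
`0 ← R/J ← F_0 ← F_1 ← F_2 ← ⋯` of `R/J`, where `R = K[x_s : s ∈ σ]` has the standard grading.
The module `F_i` is `⊕_k R(-deg i k)`, with a basis of `rank i` elements. -/
structure MinimalGradedFreeResolution (J : Ideal (MvPolynomial σ K)) where
  /-- The rank of `F_i`. -/
  rank : ℕ → ℕ
  /-- The degrees of the basis elements of `F_i`. -/
  deg : (i : ℕ) → Fin (rank i) → ℤ
  /-- The augmentation `F_0 → R/J`. -/
  aug : (Fin (rank 0) → MvPolynomial σ K) →ₗ[MvPolynomial σ K] (MvPolynomial σ K ⧸ J)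
  /-- The matrix of the differential `F_{i+1} → F_i`. -/
  diff : (i : ℕ) → Matrix (Fin (rank i)) (Fin (rank (i + 1))) (MvPolynomial σ K)
  /-- The augmentation preserves degrees. -/
  aug_homogeneous : ∀ k, ∃ p : MvPolynomial σ K, HomogeneousOfDegree p (deg 0 k) ∧
    aug (Pi.single k 1) = Ideal.Quotient.mk J p
  /-- The differentials preserve degrees. -/
  diff_homogeneous : ∀ i k l, HomogeneousOfDegree (diff i k l) (deg (i + 1) l - deg i k)
  aug_surjective : Function.Surjective aug
  exact_zero : Function.Exact (diff 0).mulVecLin aug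
  exact_succ : ∀ i, Function.Exact (diff (i + 1)).mulVecLin (diff i).mulVecLin
  /-- Minimality: the differential maps `F_{i+1}` into `(x_s : s ∈ σ) F_i`. -/
  minimal : ∀ i k l, diff i k l ∈ Ideal.span (Set.range (X : σ → MvPolynomial σ K))

/-- `β_0, β_1, β_2, …` are the Betti numbers of `R/J`: the ranks of the free modules in a (that is,
in any) minimal graded free resolution of `R/J`, which is required to exist. -/
def AreBettiNumbers (J : Ideal (MvPolynomial σ K)) (β : ℕ → ℕ) : Prop :=
  Nonempty (MinimalGradedFreeResolution J) ∧
    ∀ (F : MinimalGradedFreeResolution J) (i : ℕ), F.rank i = β i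

end Resolution

end LcmDual

end

namespace LcmDual

/-! ### Uniqueness of the Betti numbers -/

section Uniqueness

variable {R : Type*} [CommRing R]

/-! Counting variables from zero, picture the generators x_i x_j of I as the cells (i, j), i ≤ j < L
i, of a planar shape, and let e_ij be the basis vector sent to m_I/(x_i x_j). Since x_j e_ij is sent
to m_I/x_i, horizontal neighbours give the linear syzygy x_{j+1} e_{i,j+1} - x_j e_{i,j}. Vertical
neighbours do the same, and every unit square gives a relation among its four edges. The complex
squares → edges → cells → R is a minimal graded free resolution, so β_1, β_2, β_3 count cells, edges
and squares.

Exactness at the cells: syzygies of monomials are generated by the two-term ones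
(`mem_of_sum_mul_monomial_eq_zero`), and `pair_relation` writes these through edges. Cells sharing
the variable x_p lie on one path, down column p to the diagonal and then along row p; cells without
a common variable are joined through (0, 0). Exactness at the edges (`exists_boundary_of_cycle`):
coprimality of distinct variables makes the coefficients on row i divisible by x_i and those on
column j by x_j. After division the cycle condition has constant coefficients, and a discrete
potential supported on the squares solves it.

Two minimal resolutions have equal ranks (`rank_eq_rank`), so this one determines the Betti numbers.
The height is m because I lies in (x_0, …, x_{m-1}) and contains the squares of these variables;
μ(I) is the number of cells because the generators are distinct monomials of one degree. -/

theorem exists_comp_eq {ι M N : Type*} [Finite ι] [AddCommGroup M] [Module R M]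
    [AddCommGroup N] [Module R N] (f : (ι → R) →ₗ[R] M) (g : N →ₗ[R] M)
    (h : ∀ x, ∃ y, g y = f x) : ∃ k : (ι → R) →ₗ[R] N, ∀ x, g (k x) = f x := by
  classical
  choose y hy using fun i => h (Pi.single i 1)
  have key : g ∘ₗ (Pi.basisFun R ι).constr R y = f := by
    refine (Pi.basisFun R ι).ext fun i => ?_
    rw [LinearMap.comp_apply, Module.Basis.constr_basis, hy, Pi.basisFun_apply]
  exact ⟨_, fun x => LinearMap.congr_fun key x⟩

theorem apply_mem_of_forall_mem {ι κ : Type*} [Fintype ι] (I : Ideal R)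
    (f : (ι → R) →ₗ[R] (κ → R)) {x : ι → R} (hx : ∀ i, x i ∈ I) (k : κ) : f x k ∈ I := by
  classical
  rw [pi_eq_sum_univ x, map_sum, Finset.sum_apply]
  refine Ideal.sum_mem _ fun i _ => ?_
  rw [map_smul, Pi.smul_apply, smul_eq_mul]
  exact Ideal.mul_mem_right _ _ (hx i)

variable {σ K : Type*} [Field K]

theorem constantCoeff_eq_zero_of_mem {p : MvPolynomial σ K}
    (hp : p ∈ Ideal.span (Set.range (X : σ → MvPolynomial σ K))) : constantCoeff p = 0 := by
  have : Ideal.span (Set.range (X : σ → MvPolynomial σ K)) ≤ RingHom.ker constantCoeff := by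
    rw [Ideal.span_le]
    rintro _ ⟨i, rfl⟩
    simp
  exact this hp

theorem map_constantCoeff_mul_eq_one {p q : ℕ}
    (f : (Fin p → MvPolynomial σ K) →ₗ[MvPolynomial σ K] (Fin q → MvPolynomial σ K))
    (g : (Fin q → MvPolynomial σ K) →ₗ[MvPolynomial σ K] (Fin p → MvPolynomial σ K))
    (h : ∀ x k, (g (f x) - x) k ∈ Ideal.span (Set.range (X : σ → MvPolynomial σ K))) :
    (LinearMap.toMatrix' g).map constantCoeff * (LinearMap.toMatrix' f).map constantCoeff
      = (1 : Matrix (Fin p) (Fin p) K) := by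
  rw [← Matrix.map_mul, ← LinearMap.toMatrix'_comp]
  ext k l
  have := constantCoeff_eq_zero_of_mem (h (Pi.single l 1) k)
  rw [Pi.sub_apply, map_sub, sub_eq_zero] at this
  rw [Matrix.map_apply, LinearMap.toMatrix'_apply, LinearMap.comp_apply]
  rw [this, Matrix.one_apply, Pi.single_apply]
  split_ifs <;> simp

/-- Modulo the variables the two maps become mutually inverse matrices over the field `K`, and such
matrices are square. -/
theorem eq_of_inverse_mod {p q : ℕ}
    (f : (Fin p → MvPolynomial σ K) →ₗ[MvPolynomial σ K] (Fin q → MvPolynomial σ K))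
    (g : (Fin q → MvPolynomial σ K) →ₗ[MvPolynomial σ K] (Fin p → MvPolynomial σ K))
    (h : ∀ x k, (g (f x) - x) k ∈ Ideal.span (Set.range (X : σ → MvPolynomial σ K)))
    (h' : ∀ x k, (f (g x) - x) k ∈ Ideal.span (Set.range (X : σ → MvPolynomial σ K))) :
    p = q := by
  simpa using Matrix.square_of_invertible _ _ (map_constantCoeff_mul_eq_one f g h)
    (map_constantCoeff_mul_eq_one g f h')

namespace MinimalGradedFreeResolution

variable {J : Ideal (MvPolynomial σ K)}

theorem diff_apply_mem (F : MinimalGradedFreeResolution J) (i : ℕ)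
    (x : Fin (F.rank (i + 1)) → MvPolynomial σ K) (k : Fin (F.rank i)) :
    (F.diff i).mulVecLin x k ∈ Ideal.span (Set.range (X : σ → MvPolynomial σ K)) := by
  rw [Matrix.mulVecLin_apply]
  simp only [Matrix.mulVec, dotProduct]
  exact Ideal.sum_mem _ fun l _ => Ideal.mul_mem_right _ _ (F.minimal i k l)

/-- The cycles in homological degree `i`. -/
noncomputable def cycles (F : MinimalGradedFreeResolution J) :
    (i : ℕ) → Submodule (MvPolynomial σ K) (Fin (F.rank i) → MvPolynomial σ K)
  | 0 => LinearMap.ker F.aug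
  | i + 1 => LinearMap.ker (F.diff i).mulVecLin

theorem mem_cycles_iff (F : MinimalGradedFreeResolution J) (i : ℕ)
    (x : Fin (F.rank i) → MvPolynomial σ K) :
    x ∈ F.cycles i ↔ ∃ y, (F.diff i).mulVecLin y = x := by
  cases i with
  | zero => exact F.exact_zero x
  | succ i => exact F.exact_succ i x

theorem diff_mem_cycles (F : MinimalGradedFreeResolution J) (i : ℕ)
    (y : Fin (F.rank (i + 1)) → MvPolynomial σ K) :
    (F.diff i).mulVecLin y ∈ F.cycles i :=
  (F.mem_cycles_iff i _).2 ⟨y, rfl⟩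

/-- Comparison maps in degree `i` between two resolutions that are mutually inverse on cycles up to
a boundary, and mutually inverse modulo the variables. -/
theorem exists_comparison (F G : MinimalGradedFreeResolution J) (i : ℕ) :
    ∃ (f : (Fin (F.rank i) → MvPolynomial σ K) →ₗ[MvPolynomial σ K]
          (Fin (G.rank i) → MvPolynomial σ K))
      (g : (Fin (G.rank i) → MvPolynomial σ K) →ₗ[MvPolynomial σ K]
          (Fin (F.rank i) → MvPolynomial σ K))
      (s : (Fin (F.rank i) → MvPolynomial σ K) →ₗ[MvPolynomial σ K]
          (Fin (F.rank (i + 1)) → MvPolynomial σ K))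
      (t : (Fin (G.rank i) → MvPolynomial σ K) →ₗ[MvPolynomial σ K]
          (Fin (G.rank (i + 1)) → MvPolynomial σ K)),
      (∀ x ∈ F.cycles i, f x ∈ G.cycles i) ∧ (∀ x ∈ G.cycles i, g x ∈ F.cycles i) ∧
      (∀ x ∈ F.cycles i, g (f x) - x = (F.diff i).mulVecLin (s x)) ∧
      (∀ x ∈ G.cycles i, f (g x) - x = (G.diff i).mulVecLin (t x)) ∧
      (∀ x k, (g (f x) - x) k ∈ Ideal.span (Set.range (X : σ → MvPolynomial σ K))) ∧
      (∀ x k, (f (g x) - x) k ∈ Ideal.span (Set.range (X : σ → MvPolynomial σ K))) := by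
  induction i with
  | zero =>
    obtain ⟨f, hf⟩ := exists_comp_eq F.aug G.aug fun x => G.aug_surjective _
    obtain ⟨g, hg⟩ := exists_comp_eq G.aug F.aug fun x => F.aug_surjective _
    obtain ⟨s, hs⟩ := exists_comp_eq (g ∘ₗ f - LinearMap.id) (F.diff 0).mulVecLin fun x =>
      (F.mem_cycles_iff 0 _).1 (by simp [cycles, hf, hg])
    obtain ⟨t, ht⟩ := exists_comp_eq (f ∘ₗ g - LinearMap.id) (G.diff 0).mulVecLin fun x =>
      (G.mem_cycles_iff 0 _).1 (by simp [cycles, hf, hg])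
    replace hs : ∀ x, g (f x) - x = (F.diff 0).mulVecLin (s x) := fun x => (hs x).symm
    replace ht : ∀ x, f (g x) - x = (G.diff 0).mulVecLin (t x) := fun x => (ht x).symm
    refine ⟨f, g, s, t, fun x hx => ?_, fun x hx => ?_, fun x _ => hs x,
      fun x _ => ht x, fun x k => ?_, fun x k => ?_⟩
    · simpa [cycles, hf] using hx
    · simpa [cycles, hg] using hx
    · rw [hs x]; exact F.diff_apply_mem 0 (s x) k
    · rw [ht x]; exact G.diff_apply_mem 0 (t x) k
  | succ i ih =>
    obtain ⟨f, g, s, t, hf, hg, hs, ht, -, -⟩ := ih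
    obtain ⟨f', hf'⟩ := exists_comp_eq (f ∘ₗ (F.diff i).mulVecLin) (G.diff i).mulVecLin fun x =>
      (G.mem_cycles_iff i _).1 (hf _ (F.diff_mem_cycles i x))
    obtain ⟨g', hg'⟩ := exists_comp_eq (g ∘ₗ (G.diff i).mulVecLin) (F.diff i).mulVecLin fun x =>
      (F.mem_cycles_iff i _).1 (hg _ (G.diff_mem_cycles i x))
    simp only [LinearMap.comp_apply] at hf' hg'
    -- The error `g' ∘ f' - id` need not be a cycle; subtracting `s ∘ d` makes it one, so it lifts
    -- through the next differential.
    obtain ⟨s', hs'⟩ := exists_comp_eq (g' ∘ₗ f' - LinearMap.id - s ∘ₗ (F.diff i).mulVecLin)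
      (F.diff (i + 1)).mulVecLin fun x => (F.mem_cycles_iff (i + 1) _).1 (by
        change (F.diff i).mulVecLin (g' (f' x) - x - s ((F.diff i).mulVecLin x)) = 0
        rw [map_sub, map_sub, ← hs _ (F.diff_mem_cycles i x), hg', hf', sub_self])
    obtain ⟨t', ht'⟩ := exists_comp_eq (f' ∘ₗ g' - LinearMap.id - t ∘ₗ (G.diff i).mulVecLin)
      (G.diff (i + 1)).mulVecLin fun x => (G.mem_cycles_iff (i + 1) _).1 (by
        change (G.diff i).mulVecLin (f' (g' x) - x - t ((G.diff i).mulVecLin x)) = 0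
        rw [map_sub, map_sub, ← ht _ (G.diff_mem_cycles i x), hf', hg', sub_self])
    replace hs' : ∀ x, g' (f' x) - x =
        (F.diff (i + 1)).mulVecLin (s' x) + s ((F.diff i).mulVecLin x) := fun x =>
      sub_eq_iff_eq_add.1 (hs' x).symm
    replace ht' : ∀ x, f' (g' x) - x =
        (G.diff (i + 1)).mulVecLin (t' x) + t ((G.diff i).mulVecLin x) := fun x =>
      sub_eq_iff_eq_add.1 (ht' x).symm
    refine ⟨f', g', s', t', fun x hx => ?_, fun x hx => ?_, fun x hx => ?_, fun x hx => ?_,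
      fun x k => ?_, fun x k => ?_⟩
    · change (G.diff i).mulVecLin (f' x) = 0
      rw [hf', show (F.diff i).mulVecLin x = 0 from hx, map_zero]
    · change (F.diff i).mulVecLin (g' x) = 0
      rw [hg', show (G.diff i).mulVecLin x = 0 from hx, map_zero]
    · rw [hs', show (F.diff i).mulVecLin x = 0 from hx, map_zero, add_zero]
    · rw [ht', show (G.diff i).mulVecLin x = 0 from hx, map_zero, add_zero]
    -- Both terms vanish modulo the variables: the differentials by minimality, and `s` because a
    -- linear map preserves vectors with entries in an ideal.
    · rw [hs' x]
      exact add_mem (F.diff_apply_mem _ _ k) (apply_mem_of_forall_mem _ s (F.diff_apply_mem i x) k)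
    · rw [ht' x]
      exact add_mem (G.diff_apply_mem _ _ k) (apply_mem_of_forall_mem _ t (G.diff_apply_mem i x) k)

theorem rank_eq_rank (F G : MinimalGradedFreeResolution J) (i : ℕ) : F.rank i = G.rank i := by
  obtain ⟨f, g, -, -, -, -, -, -, h, h'⟩ := exists_comparison F G i
  exact eq_of_inverse_mod f g h h'

end MinimalGradedFreeResolution
end Uniqueness
end LcmDual

namespace LcmDual

/-! ### Construction of resolutions of length three -/

section Construction

variable {σ K : Type*} [Field K]

namespace HomogeneousOfDegree

theorem zero (d : ℤ) : HomogeneousOfDegree (0 : MvPolynomial σ K) d := by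
  simp [HomogeneousOfDegree]

theorem monomial (u : σ →₀ ℕ) (c : K) :
    HomogeneousOfDegree (MvPolynomial.monomial u c) (u.degree : ℤ) := by
  classical
  intro v hv
  rw [Finset.mem_singleton.1 (support_monomial_subset hv)]

theorem one : HomogeneousOfDegree (1 : MvPolynomial σ K) 0 := by
  simpa using monomial (0 : σ →₀ ℕ) (1 : K)

theorem add {p q : MvPolynomial σ K} {d : ℤ} (hp : HomogeneousOfDegree p d)
    (hq : HomogeneousOfDegree q d) : HomogeneousOfDegree (p + q) d := by
  classical
  intro u hu
  rcases Finset.mem_union.1 (support_add hu) with h | h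
  exacts [hp u h, hq u h]

theorem neg {p : MvPolynomial σ K} {d : ℤ} (hp : HomogeneousOfDegree p d) :
    HomogeneousOfDegree (-p) d := by
  intro u hu
  exact hp u (by rwa [support_neg] at hu)

theorem sub {p q : MvPolynomial σ K} {d : ℤ} (hp : HomogeneousOfDegree p d)
    (hq : HomogeneousOfDegree q d) : HomogeneousOfDegree (p - q) d := by
  rw [sub_eq_add_neg]
  exact hp.add hq.neg

theorem mul {p q : MvPolynomial σ K} {d e : ℤ} (hp : HomogeneousOfDegree p d)
    (hq : HomogeneousOfDegree q e) : HomogeneousOfDegree (p * q) (d + e) := by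
  classical
  intro u hu
  obtain ⟨a, ha, b, hb, rfl⟩ := Finset.mem_add.1 (support_mul p q hu)
  rw [map_add, Nat.cast_add, hp a ha, hq b hb]

theorem mem_span_X {p : MvPolynomial σ K} {d : ℤ} (hp : HomogeneousOfDegree p d) (hd : d ≠ 0) :
    p ∈ Ideal.span (Set.range (X : σ → MvPolynomial σ K)) := by
  rw [← Set.image_univ, mem_ideal_span_X_image]
  intro u hu
  by_contra! h
  refine hd ?_
  rw [← hp u hu, show u = 0 from Finsupp.ext fun i => h i (Set.mem_univ i)]
  simp

end HomogeneousOfDegree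

/-- Only the first differential may have degree other than one, so the basis in homological degree
`i + 1` sits in degree `e + i`. The condition `e ≠ 0` keeps units out of the first matrix. -/
theorem exists_resolution_fin {J : Ideal (MvPolynomial σ K)} {a b c : ℕ}
    (d1 : (Fin a → MvPolynomial σ K) →ₗ[MvPolynomial σ K] MvPolynomial σ K)
    (d2 : (Fin b → MvPolynomial σ K) →ₗ[MvPolynomial σ K] (Fin a → MvPolynomial σ K))
    (d3 : (Fin c → MvPolynomial σ K) →ₗ[MvPolynomial σ K] (Fin b → MvPolynomial σ K))
    (e : ℤ) (he : e ≠ 0) (hJ : LinearMap.range d1 = J) (h21 : Function.Exact d2 d1)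
    (h32 : Function.Exact d3 d2) (h3 : Function.Injective d3)
    (hd1 : ∀ k, HomogeneousOfDegree (d1 (Pi.single k 1)) e)
    (hd2 : ∀ k l, HomogeneousOfDegree (d2 (Pi.single l 1) k) 1)
    (hd3 : ∀ k l, HomogeneousOfDegree (d3 (Pi.single l 1) k) 1) :
    ∃ F : MinimalGradedFreeResolution J, F.rank 1 = a ∧ F.rank 2 = b ∧ F.rank 3 = c := by
  classical
  let d1' : (Fin a → MvPolynomial σ K) →ₗ[MvPolynomial σ K] (Fin 1 → MvPolynomial σ K) :=
    LinearMap.pi fun _ => d1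
  let rk : ℕ → ℕ
    | 0 => 1
    | 1 => a
    | 2 => b
    | 3 => c
    | _ + 4 => 0
  let dg : (i : ℕ) → Fin (rk i) → ℤ := fun i _ =>
    match i with
    | 0 => 0
    | i + 1 => e + i
  let D : (i : ℕ) → Matrix (Fin (rk i)) (Fin (rk (i + 1))) (MvPolynomial σ K)
    | 0 => LinearMap.toMatrix' d1'
    | 1 => LinearMap.toMatrix' d2
    | 2 => LinearMap.toMatrix' d3
    | _ + 3 => 0
  have D0 : (D 0).mulVecLin = d1' := Matrix.toLin'_toMatrix' d1'
  have D1 : (D 1).mulVecLin = d2 := Matrix.toLin'_toMatrix' d2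
  have D2 : (D 2).mulVecLin = d3 := Matrix.toLin'_toMatrix' d3
  have hD : ∀ i k l, HomogeneousOfDegree (D i k l) (dg (i + 1) l - dg i k) ∧
      D i k l ∈ Ideal.span (Set.range (X : σ → MvPolynomial σ K)) := by
    have one (i : ℕ) : e + ((i + 1 : ℕ) : ℤ) - (e + i) = 1 := by push_cast; ring
    rintro (_ | _ | _ | i) k l
    · have h : HomogeneousOfDegree (D 0 k l) e := by
        simpa [D, d1', LinearMap.toMatrix'_apply] using hd1 l
      exact ⟨by simpa [dg] using h, h.mem_span_X he⟩
    · have h : HomogeneousOfDegree (D 1 k l) 1 := by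
        simpa [D, LinearMap.toMatrix'_apply] using hd2 k l
      exact ⟨by simpa [dg] using h, h.mem_span_X one_ne_zero⟩
    · have h : HomogeneousOfDegree (D 2 k l) 1 := by
        simpa [D, LinearMap.toMatrix'_apply] using hd3 k l
      refine ⟨?_, h.mem_span_X one_ne_zero⟩
      convert h using 1
      exact one 1
    · exact l.elim0
  refine ⟨{ rank := rk, deg := dg, diff := D
            aug := (Submodule.mkQ J) ∘ₗ LinearMap.proj (0 : Fin 1)
            aug_homogeneous := fun k => ⟨1, by simpa [dg] using HomogeneousOfDegree.one, ?_⟩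
            diff_homogeneous := fun i k l => (hD i k l).1
            aug_surjective := ?_
            exact_zero := ?_
            exact_succ := ?_
            minimal := fun i k l => (hD i k l).2 }, rfl, rfl, rfl⟩
  · obtain rfl : k = (0 : Fin 1) := Subsingleton.elim (α := Fin 1) _ _
    rw [LinearMap.comp_apply, LinearMap.proj_apply, Pi.single_eq_same]
    rfl
  · intro y
    obtain ⟨p, rfl⟩ := Submodule.mkQ_surjective J y
    exact ⟨fun _ => p, rfl⟩
  · rw [D0]
    intro y
    rw [LinearMap.comp_apply, LinearMap.proj_apply, Submodule.mkQ_apply,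
      Submodule.Quotient.mk_eq_zero, ← hJ]
    constructor
    · rintro ⟨x, hx⟩
      exact ⟨x, funext fun i => by rw [Subsingleton.elim (α := Fin 1) i 0, ← hx]; rfl⟩
    · rintro ⟨x, rfl⟩
      exact ⟨x, rfl⟩
  · rintro (_ | _ | i)
    · rw [D0, D1]
      intro y
      rw [← h21 y]
      exact ⟨fun h => congrFun h 0, fun h => funext fun _ => h⟩
    · rw [D1, D2]
      exact h32
    · intro y
      constructor
      · intro h
        refine ⟨0, ?_⟩
        -- For `i = 0` exactness is the injectivity of `d3`; afterwards the module in the middle is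
        -- zero.
        cases i with
        | zero =>
          rw [D2] at h
          rw [map_zero]
          exact (h3 (h.trans (map_zero d3).symm)).symm
        | succ i => exact funext fun k => k.elim0
      · rintro ⟨x, rfl⟩
        have : x = 0 := funext fun k => k.elim0
        rw [this, map_zero, map_zero]

theorem exists_resolution {J : Ideal (MvPolynomial σ K)} {A B C : Type*}
    [Fintype A] [Fintype B] [Fintype C] [DecidableEq A] [DecidableEq B] [DecidableEq C]
    (d1 : (A → MvPolynomial σ K) →ₗ[MvPolynomial σ K] MvPolynomial σ K)
    (d2 : (B → MvPolynomial σ K) →ₗ[MvPolynomial σ K] (A → MvPolynomial σ K))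
    (d3 : (C → MvPolynomial σ K) →ₗ[MvPolynomial σ K] (B → MvPolynomial σ K))
    (e : ℤ) (he : e ≠ 0) (hJ : LinearMap.range d1 = J) (h21 : Function.Exact d2 d1)
    (h32 : Function.Exact d3 d2) (h3 : Function.Injective d3)
    (hd1 : ∀ k, HomogeneousOfDegree (d1 (Pi.single k 1)) e)
    (hd2 : ∀ k l, HomogeneousOfDegree (d2 (Pi.single l 1) k) 1)
    (hd3 : ∀ k l, HomogeneousOfDegree (d3 (Pi.single l 1) k) 1) :
    ∃ F : MinimalGradedFreeResolution J,
      F.rank 1 = Fintype.card A ∧ F.rank 2 = Fintype.card B ∧ F.rank 3 = Fintype.card C := by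
  let R := MvPolynomial σ K
  let EA := LinearEquiv.funCongrLeft R R (Fintype.equivFin A)
  let EB := LinearEquiv.funCongrLeft R R (Fintype.equivFin B)
  let EC := LinearEquiv.funCongrLeft R R (Fintype.equivFin C)
  have hA (k) : EA (Pi.single k 1) = Pi.single ((Fintype.equivFin A).symm k) 1 := by
    ext j; simp [EA, Pi.single_apply, Equiv.eq_symm_apply]
  have hB (k) : EB (Pi.single k 1) = Pi.single ((Fintype.equivFin B).symm k) 1 := by
    ext j; simp [EB, Pi.single_apply, Equiv.eq_symm_apply]
  have hC (k) : EC (Pi.single k 1) = Pi.single ((Fintype.equivFin C).symm k) 1 := by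
    ext j; simp [EC, Pi.single_apply, Equiv.eq_symm_apply]
  refine exists_resolution_fin (d1 ∘ₗ EA.toLinearMap)
    (EA.symm.toLinearMap ∘ₗ d2 ∘ₗ EB.toLinearMap) (EB.symm.toLinearMap ∘ₗ d3 ∘ₗ EC.toLinearMap)
    e he ?_ ?_ ?_ ?_ ?_ ?_ ?_
  · rw [LinearMap.range_comp_of_range_eq_top _ (LinearEquiv.range EA), hJ]
  · intro y
    simp only [LinearMap.comp_apply, LinearEquiv.coe_coe]
    rw [h21 (EA y)]
    constructor
    · rintro ⟨z, hz⟩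
      exact ⟨EB.symm z, by simp [hz]⟩
    · rintro ⟨z, rfl⟩
      exact ⟨EB z, by simp⟩
  · intro y
    simp only [LinearMap.comp_apply, LinearEquiv.coe_coe, LinearEquiv.map_eq_zero_iff]
    rw [h32 (EB y)]
    constructor
    · rintro ⟨z, hz⟩
      exact ⟨EC.symm z, by simp [hz]⟩
    · rintro ⟨z, rfl⟩
      exact ⟨EC z, by simp⟩
  · exact EB.symm.injective.comp (h3.comp EC.injective)
  · intro k
    simpa only [LinearMap.comp_apply, LinearEquiv.coe_coe, hA] using hd1 _
  · intro k l
    simp only [LinearMap.comp_apply, LinearEquiv.coe_coe, hB]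
    exact hd2 ((Fintype.equivFin A).symm k) _
  · intro k l
    simp only [LinearMap.comp_apply, LinearEquiv.coe_coe, hC]
    exact hd3 ((Fintype.equivFin B).symm k) _

end Construction

end LcmDual

namespace LcmDual

/-! ### The planar complex of a shape -/

section Planar

variable {R : Type*} [CommRing R] {x : ℕ → R} {n : ℕ} {L : ℕ → ℕ}

/-- Here `r` and `v` are the coefficients on horizontal and vertical edges, `s` those on squares,
and `h` says that the boundary vanishes at every cell. Extension by zero lets each induction run
over all of ℕ × ℕ. -/
theorem exists_boundary_of_cycle (hLn : ∀ i, L i ≤ n)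
    (hreg : ∀ i a, x i * a = 0 → a = 0)
    (hcop : ∀ i j a b, i ≠ j → x i * a = x j * b → ∃ q, a = x j * q ∧ b = x i * q)
    {r v : ℕ → ℕ → R} (hr : ∀ i j, ¬(i < j ∧ j < L i) → r i j = 0)
    (hv : ∀ i j, ¬(0 < i ∧ i ≤ j ∧ j < L i) → v i j = 0)
    (h : ∀ i j, x j * (r i j - r i (j + 1)) + x i * (v i j - v (i + 1) j) = 0) :
    ∃ s : ℕ → ℕ → R, (∀ i j, ¬(0 < i ∧ i < j ∧ j < L i) → s i j = 0) ∧
      (∀ i j, r i j = x i * (s i j - s (i + 1) j)) ∧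
      ∀ i j, v i j = -(x j * (s i j - s i (j + 1))) := by
  have hq : ∀ i j, i ≠ j → ∃ q, r i j = r i (j + 1) + x i * q ∧ v (i + 1) j = v i j + x j * q := by
    intro i j hij
    obtain ⟨q, h1, h2⟩ := hcop i j (v (i + 1) j - v i j) (r i j - r i (j + 1)) hij
      (by linear_combination -h i j)
    exact ⟨q, by linear_combination h2, by linear_combination h1⟩
  -- Induction leftwards along a row: `r` vanishes from column `n` on, and each step to the left
  -- adds a multiple of `x i`. For `v` the induction runs down a column from row 0.
  have hrdvd : ∀ k i j, n ≤ j + k → ∃ a, r i j = x i * a := by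
    intro k
    induction k with
    | zero => exact fun i j hj => ⟨0, by rw [hr i j (by have := hLn i; omega), mul_zero]⟩
    | succ k ih =>
      intro i j hj
      by_cases hij : i < j
      · obtain ⟨a, ha⟩ := ih i (j + 1) (by omega)
        obtain ⟨q, hq, -⟩ := hq i j hij.ne
        exact ⟨a + q, by rw [hq, ha]; ring⟩
      · exact ⟨0, by rw [hr i j (by omega), mul_zero]⟩
  have hvdvd : ∀ i j, ∃ a, v i j = x j * a := by
    intro i j
    induction i with
    | zero => exact ⟨0, by rw [hv 0 j (by omega), mul_zero]⟩
    | succ i ih =>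
      by_cases hij : i < j
      · obtain ⟨a, ha⟩ := ih
        obtain ⟨q, -, hq⟩ := hq i j hij.ne
        exact ⟨a + q, by rw [hq, ha]; ring⟩
      · exact ⟨0, by rw [hv _ j (by omega), mul_zero]⟩
  choose r' hr' using fun i j => hrdvd n i j (by omega)
  choose v' hv' using hvdvd
  have hcyc : ∀ i j, r' i j - r' i (j + 1) + (v' i j - v' (i + 1) j) = 0 := by
    intro i j
    refine hreg i _ (hreg j _ ?_)
    rw [← h i j, hr', hr', hv', hv']
    ring
  have hr0 : ∀ i j, ¬(i < j ∧ j < L i) → r' i j = 0 := fun i j hij =>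
    hreg i _ (by rw [← hr', hr i j hij])
  have hv0 : ∀ i j, ¬(0 < i ∧ i ≤ j ∧ j < L i) → v' i j = 0 := fun i j hij =>
    hreg j _ (by rw [← hv', hv i j hij])
  -- The potential is minus the sum of a column above row `i`. Its vertical differences are `r'` by
  -- definition, its horizontal ones are `-v'` by the divided cycle condition.
  let s : ℕ → ℕ → R := fun i j => -∑ k ∈ Finset.range i, r' k j
  have hs1 : ∀ i j, r' i j = s i j - s (i + 1) j := by
    intro i j
    simp only [s, Finset.sum_range_succ]
    ring
  have hs0 : ∀ j, s 0 j = 0 := fun j => by simp [s]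
  have hs2 : ∀ i j, v' i j = -(s i j - s i (j + 1)) := by
    intro i j
    induction i with
    | zero => rw [hs0, hs0, hv0 0 j (by omega)]; ring
    | succ i ih => linear_combination ih - hcyc i j + hs1 i j - hs1 i (j + 1)
  -- Where `v'` vanishes, `s` is constant along rows. Zeros therefore spread from column 0 up to the
  -- diagonal, and in `hright` from column `n` back to the end of the row.
  have hleft : ∀ i j, j ≤ i → s i j = 0 := by
    intro i j
    induction j with
    | zero =>
      intro _
      simp only [s]
      rw [Finset.sum_eq_zero fun k _ => hr0 k 0 (by omega), neg_zero]
    | succ j ih =>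
      intro hj
      have := hs2 i j
      rw [hv0 i j (by omega), ih (by omega)] at this
      linear_combination -this
  have hright : ∀ k i j, L i ≤ j → n ≤ j + k → s i j = 0 := by
    intro k
    induction k with
    | zero =>
      intro i j _ hj
      simp only [s]
      rw [Finset.sum_eq_zero fun k _ => hr0 k j (by have := hLn k; omega), neg_zero]
    | succ k ih =>
      intro i j h1 h2
      have := hs2 i j
      rw [hv0 i j (by omega), ih i (j + 1) (by omega) (by omega)] at this
      linear_combination this
  refine ⟨s, fun i j hij => ?_, fun i j => by rw [hr', hs1], fun i j => by rw [hv', hs2]; ring⟩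
  by_cases h1 : j ≤ i
  · exact hleft i j h1
  by_cases h2 : L i ≤ j
  · exact hright n i j h2 (by omega)
  · obtain rfl : i = 0 := by omega
    exact hs0 j

/-- After cancelling `x i`, `s` is constant along columns, and its top row is zero. -/
theorem eq_zero_of_boundary_eq_zero (hreg : ∀ i a, x i * a = 0 → a = 0) {s : ℕ → ℕ → R}
    (hs : ∀ j, s 0 j = 0) (h : ∀ i j, x i * (s i j - s (i + 1) j) = 0) (i j : ℕ) : s i j = 0 := by
  induction i with
  | zero => exact hs j
  | succ i ih => linear_combination ih - hreg i _ (h i j)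

/-- The value at `(i, j)` of the extension by zero of a function on a finite set of cells. -/
def extend (S : Finset (ℕ × ℕ)) (i j : ℕ) : (S → R) →ₗ[R] R :=
  if h : (i, j) ∈ S then LinearMap.proj ⟨(i, j), h⟩ else 0

theorem extend_coe (S : Finset (ℕ × ℕ)) (p : S) (f : S → R) : extend S p.1.1 p.1.2 f = f p := by
  rw [extend, dif_pos p.2]
  rfl

theorem extend_of_mem {S : Finset (ℕ × ℕ)} {i j : ℕ} (h : (i, j) ∈ S) (f : S → R) :
    extend S i j f = f ⟨(i, j), h⟩ := by
  rw [extend, dif_pos h]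
  rfl

theorem extend_of_notMem {S : Finset (ℕ × ℕ)} {i j : ℕ} (h : (i, j) ∉ S) (f : S → R) :
    extend S i j f = 0 := by
  rw [extend, dif_neg h]
  rfl

/-- The extension by zero of the restriction of a function supported on `S`. -/
theorem extend_restrict {S : Finset (ℕ × ℕ)} {f : ℕ → ℕ → R} (hf : ∀ i j, (i, j) ∉ S → f i j = 0)
    (i j : ℕ) : extend S i j (fun p => f p.1.1 p.1.2) = f i j := by
  by_cases h : (i, j) ∈ S
  · rw [extend_of_mem h]
  · rw [extend_of_notMem h, hf i j h]

theorem extend_ext {S : Finset (ℕ × ℕ)} {f g : S → R}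
    (h : ∀ i j, extend S i j f = extend S i j g) : f = g := by
  funext p
  rw [← extend_coe S p f, ← extend_coe S p g, h]

variable (n L)

/-- The cells of the shape: one for every generator of the strongly stable ideal. -/
def cells : Finset (ℕ × ℕ) :=
  (Finset.range n ×ˢ Finset.range n).filter fun p => p.1 ≤ p.2 ∧ p.2 < L p.1

/-- The horizontal edges, indexed by their right ends. -/
def rowEdges : Finset (ℕ × ℕ) := (cells n L).filter fun p => p.1 < p.2

/-- The vertical edges, indexed by their lower ends. -/
def colEdges : Finset (ℕ × ℕ) := (cells n L).filter fun p => 0 < p.1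

/-- The unit squares, indexed by their lower right corners. -/
def squares : Finset (ℕ × ℕ) := (cells n L).filter fun p => 0 < p.1 ∧ p.1 < p.2

variable {n L}

theorem mem_cells (hLn : ∀ i, L i ≤ n) {i j : ℕ} : (i, j) ∈ cells n L ↔ i ≤ j ∧ j < L i := by
  have := hLn i
  simp only [cells, Finset.mem_filter, Finset.mem_product, Finset.mem_range]
  omega

theorem mem_rowEdges (hLn : ∀ i, L i ≤ n) {i j : ℕ} :
    (i, j) ∈ rowEdges n L ↔ i < j ∧ j < L i := by
  rw [rowEdges, Finset.mem_filter, mem_cells hLn]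
  grind

theorem mem_colEdges (hLn : ∀ i, L i ≤ n) {i j : ℕ} :
    (i, j) ∈ colEdges n L ↔ 0 < i ∧ i ≤ j ∧ j < L i := by
  rw [colEdges, Finset.mem_filter, mem_cells hLn]
  grind

theorem mem_squares (hLn : ∀ i, L i ≤ n) {i j : ℕ} :
    (i, j) ∈ squares n L ↔ 0 < i ∧ i < j ∧ j < L i := by
  rw [squares, Finset.mem_filter, mem_cells hLn]
  grind

theorem lt_of_mem_cells {p : ℕ × ℕ} (h : p ∈ cells n L) : p.1 < n ∧ p.2 < n := by
  simp only [cells, Finset.mem_filter, Finset.mem_product, Finset.mem_range] at h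
  exact h.1

variable (x n L)

/-- The differential from edges to cells. -/
def edgeBoundary : (rowEdges n L ⊕ colEdges n L → R) →ₗ[R] (cells n L → R) :=
  LinearMap.pi fun p =>
    x p.1.2 • (extend (rowEdges n L) p.1.1 p.1.2 - extend (rowEdges n L) p.1.1 (p.1.2 + 1)) ∘ₗ
      LinearMap.funLeft R R Sum.inl +
    x p.1.1 • (extend (colEdges n L) p.1.1 p.1.2 - extend (colEdges n L) (p.1.1 + 1) p.1.2) ∘ₗ
      LinearMap.funLeft R R Sum.inr

/-- The differential from squares to edges. -/
def squareBoundary : (squares n L → R) →ₗ[R] (rowEdges n L ⊕ colEdges n L → R) :=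
  LinearMap.pi (Sum.elim
    (fun p => x p.1.1 • (extend (squares n L) p.1.1 p.1.2 - extend (squares n L) (p.1.1 + 1) p.1.2))
    (fun p =>
      -(x p.1.2 • (extend (squares n L) p.1.1 p.1.2 - extend (squares n L) p.1.1 (p.1.2 + 1)))))

variable {x n L}

theorem edgeBoundary_apply (f : rowEdges n L ⊕ colEdges n L → R) (p : cells n L) :
    edgeBoundary x n L f p =
      x p.1.2 * (extend (rowEdges n L) p.1.1 p.1.2 (f ∘ Sum.inl) -
        extend (rowEdges n L) p.1.1 (p.1.2 + 1) (f ∘ Sum.inl)) +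
      x p.1.1 * (extend (colEdges n L) p.1.1 p.1.2 (f ∘ Sum.inr) -
        extend (colEdges n L) (p.1.1 + 1) p.1.2 (f ∘ Sum.inr)) :=
  rfl

theorem squareBoundary_apply_inl (f : squares n L → R) (p : rowEdges n L) :
    squareBoundary x n L f (Sum.inl p) = x p.1.1 *
      (extend (squares n L) p.1.1 p.1.2 f - extend (squares n L) (p.1.1 + 1) p.1.2 f) :=
  rfl

theorem squareBoundary_apply_inr (f : squares n L → R) (p : colEdges n L) :
    squareBoundary x n L f (Sum.inr p) = -(x p.1.2 *
      (extend (squares n L) p.1.1 p.1.2 f - extend (squares n L) p.1.1 (p.1.2 + 1) f)) :=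
  rfl

/-- Outside the shape all four terms vanish: an edge in the shape has both ends in it. For the upper
end of a vertical edge this is where `L` must be antitone. -/
theorem extend_edgeBoundary (hL : Antitone L) (hLn : ∀ i, L i ≤ n)
    (f : rowEdges n L ⊕ colEdges n L → R) (i j : ℕ) :
    extend (cells n L) i j (edgeBoundary x n L f) =
      x j * (extend (rowEdges n L) i j (f ∘ Sum.inl) -
        extend (rowEdges n L) i (j + 1) (f ∘ Sum.inl)) +
      x i * (extend (colEdges n L) i j (f ∘ Sum.inr) -
        extend (colEdges n L) (i + 1) j (f ∘ Sum.inr)) := by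
  have hLi := hL (Nat.le_succ i)
  by_cases h : (i, j) ∈ cells n L
  · rw [extend_of_mem h, edgeBoundary_apply]
  · rw [extend_of_notMem h]
    rw [mem_cells hLn] at h
    rw [extend_of_notMem, extend_of_notMem, extend_of_notMem, extend_of_notMem]
    · ring
    all_goals (simp only [mem_rowEdges hLn, mem_colEdges hLn]; grind)

theorem extend_squareBoundary_inl (hL : Antitone L) (hLn : ∀ i, L i ≤ n)
    (f : squares n L → R) (i j : ℕ) :
    extend (rowEdges n L) i j (squareBoundary x n L f ∘ Sum.inl) =
      x i * (extend (squares n L) i j f - extend (squares n L) (i + 1) j f) := by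
  have hLi := hL (Nat.le_succ i)
  by_cases h : (i, j) ∈ rowEdges n L
  · rw [extend_of_mem h, Function.comp_apply, squareBoundary_apply_inl]
  · rw [extend_of_notMem h]
    rw [mem_rowEdges hLn] at h
    rw [extend_of_notMem, extend_of_notMem]
    · ring
    all_goals (simp only [mem_squares hLn]; grind)

theorem extend_squareBoundary_inr (hLn : ∀ i, L i ≤ n) (f : squares n L → R) (i j : ℕ) :
    extend (colEdges n L) i j (squareBoundary x n L f ∘ Sum.inr) =
      -(x j * (extend (squares n L) i j f - extend (squares n L) i (j + 1) f)) := by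
  by_cases h : (i, j) ∈ colEdges n L
  · rw [extend_of_mem h, Function.comp_apply, squareBoundary_apply_inr]
  · rw [extend_of_notMem h]
    rw [mem_colEdges hLn] at h
    rw [extend_of_notMem, extend_of_notMem]
    · ring
    all_goals (simp only [mem_squares hLn]; grind)

theorem squareBoundary_injective (hL : Antitone L) (hLn : ∀ i, L i ≤ n)
    (hreg : ∀ i a, x i * a = 0 → a = 0) : Function.Injective (squareBoundary x n L) := by
  rw [← LinearMap.ker_eq_bot, LinearMap.ker_eq_bot']
  intro f hf
  refine extend_ext fun i j => ?_
  rw [map_zero]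
  refine eq_zero_of_boundary_eq_zero hreg (s := fun i j => extend (squares n L) i j f)
    (fun j => extend_of_notMem (by simp [mem_squares hLn]) _) (fun i j => ?_) i j
  rw [← extend_squareBoundary_inl hL hLn, hf]
  exact map_zero _

theorem exact_squareBoundary_edgeBoundary (hL : Antitone L) (hLn : ∀ i, L i ≤ n)
    (hreg : ∀ i a, x i * a = 0 → a = 0)
    (hcop : ∀ i j a b, i ≠ j → x i * a = x j * b → ∃ q, a = x j * q ∧ b = x i * q) :
    Function.Exact (squareBoundary x n L) (edgeBoundary x n L) := by
  intro f
  constructor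
  · intro hf
    obtain ⟨s, hs, h1, h2⟩ := exists_boundary_of_cycle hLn hreg hcop
      (r := fun i j => extend (rowEdges n L) i j (f ∘ Sum.inl))
      (v := fun i j => extend (colEdges n L) i j (f ∘ Sum.inr))
      (fun i j h => extend_of_notMem (by rwa [mem_rowEdges hLn]) _)
      (fun i j h => extend_of_notMem (by rwa [mem_colEdges hLn]) _)
      (fun i j => by rw [← extend_edgeBoundary hL hLn, hf, map_zero])
    have hs' : ∀ i j, (i, j) ∉ squares n L → s i j = 0 := fun i j h =>
      hs i j (by rwa [mem_squares hLn] at h)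
    refine ⟨fun p => s p.1.1 p.1.2, funext ?_⟩
    rintro (p | p)
    · rw [squareBoundary_apply_inl, extend_restrict hs', extend_restrict hs', ← h1, extend_coe]
      rfl
    · rw [squareBoundary_apply_inr, extend_restrict hs', extend_restrict hs', ← h2, extend_coe]
      rfl
  · rintro ⟨s, rfl⟩
    refine extend_ext fun i j => ?_
    rw [extend_edgeBoundary hL hLn, map_zero]
    simp only [extend_squareBoundary_inl hL hLn, extend_squareBoundary_inr hLn]
    ring

end Planar

end LcmDual

namespace LcmDual

/-! ### Syzygies of monomials -/

section Syzygies

variable {σ K A : Type*} [Field K] [Fintype A] [DecidableEq A]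

/-- A module of relations contains all syzygies of the monomials with exponents `w a` as soon as it
contains those that are differences of two terms. -/
theorem mem_of_sum_mul_monomial_eq_zero (w : A → σ →₀ ℕ)
    (N : Submodule (MvPolynomial σ K) (A → MvPolynomial σ K))
    (h : ∀ a b s t, s + w a = t + w b →
      monomial s (1 : K) • (Pi.single a 1 : A → MvPolynomial σ K) -
        monomial t (1 : K) • (Pi.single b 1 : A → MvPolynomial σ K) ∈ N)
    {c : A → MvPolynomial σ K} (hc : ∑ a, c a * monomial (w a) (1 : K) = 0) : c ∈ N := by
  classical
  -- A `K`-linear map that reads off the class of `c` from the sum `∑ c a * x^(w a)`. Each monomial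
  -- divisible by some `x^(w a)` is assigned one such `a`; by `h` the class does not depend on the
  -- choice. The value 0 on other monomials plays no role.
  let τ : MvPolynomial σ K →ₗ[K] (A → MvPolynomial σ K) ⧸ N :=
    (basisMonomials σ K).constr K fun s =>
      if hs : ∃ a, w a ≤ s then
        N.mkQ (monomial (s - w hs.choose) (1 : K) •
          (Pi.single hs.choose 1 : A → MvPolynomial σ K))
      else 0
  have hτ1 : ∀ a s, τ (monomial (s + w a) 1) = N.mkQ (monomial s (1 : K) •
      (Pi.single a 1 : A → MvPolynomial σ K)) := by
    intro a s
    have hs : ∃ b, w b ≤ s + w a := ⟨a, le_add_self⟩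
    rw [← congrFun (coe_basisMonomials σ K) (s + w a), Module.Basis.constr_basis, dif_pos hs,
      Submodule.mkQ_apply, Submodule.mkQ_apply, Submodule.Quotient.eq]
    exact h _ _ _ _ (tsub_add_cancel_of_le hs.choose_spec)
  have hτ : ∀ a p, τ (p * monomial (w a) 1) = N.mkQ (p •
      (Pi.single a 1 : A → MvPolynomial σ K)) := by
    intro a p
    induction p using MvPolynomial.induction_on' with
    | monomial s k =>
      have hk : monomial s k = k • monomial s (1 : K) := by
        rw [smul_monomial, smul_eq_mul, mul_one]
      rw [hk, smul_mul_assoc, monomial_mul, one_mul, map_smul, hτ1, smul_assoc]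
      rfl
    | add p q hp hq => rw [add_mul, map_add, hp, hq, add_smul, map_add]
  have key : N.mkQ c = τ (∑ a, c a * monomial (w a) (1 : K)) := by
    rw [map_sum]
    conv_lhs => rw [pi_eq_sum_univ' c]
    rw [map_sum]
    exact Finset.sum_congr rfl fun a _ => (hτ a (c a)).symm
  rw [hc, map_zero, Submodule.mkQ_apply, Submodule.Quotient.mk_eq_zero] at key
  exact key

end Syzygies

/-! ### Variables, cells, and the connection of any two cells by edges -/

section Cells

variable (n : ℕ) (K : Type*) [Field K]

/-- The exponent vector of the variable with number `i`, counted from zero. -/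
noncomputable def varExponent (i : ℕ) : Fin n →₀ ℕ :=
  if h : i < n then Finsupp.single ⟨i, h⟩ 1 else 0

/-- The variable with number `i`, counted from zero; it is `1` if there is none. -/
noncomputable def varX (i : ℕ) : MvPolynomial (Fin n) K :=
  monomial (varExponent n i) 1

variable {n K}

theorem varExponent_of_lt {i : ℕ} (h : i < n) : varExponent n i = Finsupp.single ⟨i, h⟩ 1 :=
  dif_pos h

theorem varX_of_lt {i : ℕ} (h : i < n) : varX n K i = X ⟨i, h⟩ := by
  rw [varX, varExponent_of_lt h]
  rfl

theorem varX_of_le {i : ℕ} (h : n ≤ i) : varX n K i = 1 := by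
  rw [varX, varExponent, dif_neg (by omega)]
  rfl

theorem varX_ne_zero (i : ℕ) : varX n K i ≠ 0 := by
  simp [varX]

theorem eq_zero_of_varX_mul_eq_zero (i : ℕ) (a : MvPolynomial (Fin n) K)
    (h : varX n K i * a = 0) : a = 0 :=
  (mul_eq_zero.1 h).resolve_left (varX_ne_zero i)

/-- Distinct variables are non-associated primes. An index beyond the last variable stands for 1,
which is coprime to everything, so no bound on the indices is needed. -/
theorem exists_of_varX_mul_eq (i j : ℕ) (a b : MvPolynomial (Fin n) K) (hij : i ≠ j)
    (h : varX n K i * a = varX n K j * b) :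
    ∃ q, a = varX n K j * q ∧ b = varX n K i * q := by
  rcases le_or_gt n i with hi | hi
  · rw [varX_of_le hi, one_mul] at h
    exact ⟨b, h, by rw [varX_of_le hi, one_mul]⟩
  rcases le_or_gt n j with hj | hj
  · rw [varX_of_le hj, one_mul] at h
    exact ⟨a, by rw [varX_of_le hj, one_mul], h.symm⟩
  have hdvd : varX n K i ∣ b := by
    have hb : varX n K i ∣ varX n K j * b := ⟨a, h.symm⟩
    rw [varX_of_lt hi, varX_of_lt hj] at hb
    rw [varX_of_lt hi]
    refine ((X_prime (R := K) (i := (⟨i, hi⟩ : Fin n))).dvd_or_dvd hb).resolve_left fun hX => hij ?_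
    simpa using hX
  obtain ⟨q, rfl⟩ := hdvd
  refine ⟨q, mul_left_cancel₀ (varX_ne_zero i) ?_, rfl⟩
  rw [h]
  ring

/-- The exponent vector of the generator belonging to a cell. -/
noncomputable def cellExponent (n : ℕ) (p : ℕ × ℕ) : Fin n →₀ ℕ :=
  varExponent n p.1 + varExponent n p.2

variable {L : ℕ → ℕ}

/-- The basis vector belonging to the cell in row `min i j` and column `max i j`. -/
noncomputable def cellVector (n : ℕ) (K : Type*) [Field K] (L : ℕ → ℕ) (i j : ℕ) :
    cells n L → MvPolynomial (Fin n) K :=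
  fun p => if p.1 = (min i j, max i j) then 1 else 0

theorem cellVector_comm (i j : ℕ) : cellVector n K L i j = cellVector n K L j i := by
  unfold cellVector
  rw [min_comm, max_comm]

theorem cellVector_eq_single (p : cells n L) (hp : p.1.1 ≤ p.1.2) :
    cellVector n K L p.1.1 p.1.2 = Pi.single p 1 := by
  funext q
  rw [cellVector, min_eq_left hp, max_eq_right hp, Pi.single_apply]
  simp only [Prod.mk.eta, Subtype.ext_iff]

theorem extend_single {R : Type*} [CommRing R] {S : Finset (ℕ × ℕ)} (e : S) (i j : ℕ) :
    extend S i j (Pi.single e (1 : R)) = if (i, j) = e.1 then 1 else 0 := by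
  by_cases h : (i, j) ∈ S
  · rw [extend_of_mem h, Pi.single_apply]
    simp only [Subtype.ext_iff]
  · rw [extend_of_notMem h, if_neg fun he : (i, j) = e.1 => h (he ▸ e.2)]

theorem edgeBoundary_single_inl {i j : ℕ} (hij : i ≤ j) (he : (i, j + 1) ∈ rowEdges n L) :
    edgeBoundary (varX n K) n L (Sum.elim (Pi.single ⟨(i, j + 1), he⟩ 1) 0) =
      varX n K (j + 1) • cellVector n K L i (j + 1) - varX n K j • cellVector n K L i j := by
  funext p
  rw [edgeBoundary_apply, Sum.elim_comp_inl, Sum.elim_comp_inr, extend_single, extend_single,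
    map_zero, map_zero]
  obtain ⟨⟨a, b⟩, hp⟩ := p
  simp only [Pi.sub_apply, Pi.smul_apply, smul_eq_mul, cellVector, Prod.mk.injEq]
  rw [min_eq_left hij, max_eq_right hij, min_eq_left (by omega), max_eq_right (by omega)]
  grind

theorem edgeBoundary_single_inr {i j : ℕ} (hij : i + 1 ≤ j) (he : (i + 1, j) ∈ colEdges n L) :
    edgeBoundary (varX n K) n L (Sum.elim 0 (Pi.single ⟨(i + 1, j), he⟩ 1)) =
      varX n K (i + 1) • cellVector n K L (i + 1) j - varX n K i • cellVector n K L i j := by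
  funext p
  rw [edgeBoundary_apply, Sum.elim_comp_inl, Sum.elim_comp_inr, extend_single, extend_single,
    map_zero, map_zero]
  obtain ⟨⟨a, b⟩, hp⟩ := p
  simp only [Pi.sub_apply, Pi.smul_apply, smul_eq_mul, cellVector, Prod.mk.injEq]
  rw [min_eq_left hij, max_eq_right hij, min_eq_left (by omega), max_eq_right (by omega)]
  grind

theorem row_relation (hLn : ∀ i, L i ≤ n) {i j : ℕ} (hij : i ≤ j) (hj : j + 1 < L i) :
    varX n K (j + 1) • cellVector n K L i (j + 1) - varX n K j • cellVector n K L i j ∈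
      LinearMap.range (edgeBoundary (varX n K) n L) :=
  ⟨_, edgeBoundary_single_inl hij ((mem_rowEdges hLn).2 ⟨by omega, hj⟩)⟩

theorem col_relation (hLn : ∀ i, L i ≤ n) {i j : ℕ} (hij : i + 1 ≤ j) (hj : j < L (i + 1)) :
    varX n K (i + 1) • cellVector n K L (i + 1) j - varX n K i • cellVector n K L i j ∈
      LinearMap.range (edgeBoundary (varX n K) n L) :=
  ⟨_, edgeBoundary_single_inr hij ((mem_colEdges hLn).2 ⟨by omega, hij, hj⟩)⟩

/-- All terms on the path of cells that involve the variable `p` are congruent. -/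
theorem path_relation (hL : Antitone L) (hLn : ∀ i, L i ≤ n) {p q : ℕ}
    (h : max p q < L (min p q)) :
    varX n K q • cellVector n K L p q - varX n K 0 • cellVector n K L p 0 ∈
      LinearMap.range (edgeBoundary (varX n K) n L) := by
  -- Up to the diagonal the path is column `p`, whose cells are (i, p); antitonicity of `L` keeps
  -- all cells above a given one in the shape.
  have hcol : ∀ i, i ≤ p → p < L i →
      varX n K i • cellVector n K L p i - varX n K 0 • cellVector n K L p 0 ∈
        LinearMap.range (edgeBoundary (varX n K) n L) := by
    intro i
    induction i with
    | zero => simp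
    | succ i ih =>
      intro hi hp
      rw [← sub_add_sub_cancel _ (varX n K i • cellVector n K L p i) _]
      refine add_mem ?_ (ih (by omega) (hp.trans_le (hL (Nat.le_succ i))))
      rw [cellVector_comm p, cellVector_comm p]
      exact col_relation hLn hi hp
  rcases le_total q p with hqp | hpq
  · rw [max_eq_left hqp, min_eq_right hqp] at h
    exact hcol q hqp h
  · rw [max_eq_right hpq, min_eq_left hpq] at h
    -- Past the diagonal cell (p, p) the path continues along row `p`.
    induction q, hpq using Nat.le_induction with
    | base => exact hcol p le_rfl h
    | succ q hpq ih =>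
      rw [← sub_add_sub_cancel _ (varX n K q • cellVector n K L p q) _]
      exact add_mem (row_relation hLn hpq h) (ih (by omega))

theorem base_relation (hL : Antitone L) (hLn : ∀ i, L i ≤ n) {p q : ℕ}
    (h : max p q < L (min p q)) :
    (varX n K p * varX n K q) • cellVector n K L p q -
      (varX n K 0 * varX n K 0) • cellVector n K L 0 0 ∈
      LinearMap.range (edgeBoundary (varX n K) n L) := by
  have hp : max 0 p < L (min 0 p) := by
    have h1 := hL (Nat.zero_le (min p q))
    have h2 := le_max_left p q
    simp only [Nat.zero_max, Nat.zero_min]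
    omega
  -- Two paths in succession: from (p, q) to (0, p) along the cells containing `p`, then to (0, 0)
  -- along the top row.
  have h1 := Submodule.smul_mem _ (varX n K p) (path_relation (K := K) hL hLn h)
  have h2 := Submodule.smul_mem _ (varX n K 0) (path_relation (K := K) hL hLn hp)
  have := add_mem h1 h2
  rw [smul_sub, smul_sub, smul_smul, smul_smul, smul_smul, smul_smul, cellVector_comm p 0,
    mul_comm (varX n K p) (varX n K 0), sub_add_sub_cancel] at this
  exact this

theorem varX_mul_monomial (c : Fin n →₀ ℕ) (i : ℕ) :
    monomial (c + varExponent n i) (1 : K) = monomial c 1 * varX n K i := by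
  rw [varX, monomial_mul, one_mul]

theorem shared_relation (hL : Antitone L) (hLn : ∀ i, L i ≤ n) {p q q' : ℕ} (hq : q < n)
    (hq' : q' < n) (h : max p q < L (min p q)) (h' : max p q' < L (min p q')) {s t : Fin n →₀ ℕ}
    (hst : s + varExponent n q' = t + varExponent n q) :
    monomial s (1 : K) • cellVector n K L p q - monomial t (1 : K) • cellVector n K L p q' ∈
      LinearMap.range (edgeBoundary (varX n K) n L) := by
  by_cases hqq : q = q'
  · subst hqq
    rw [add_right_cancel hst, sub_self]
    exact zero_mem _
  -- Distinct variables are coprime, so the two multipliers are a common monomial times `x_q` and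
  -- `x_q'`, and both terms compare with the start of the path of `p`.
  have hle : varExponent n q ≤ s := by
    intro k
    have := DFunLike.congr_fun hst k
    rw [varExponent_of_lt hq, varExponent_of_lt hq'] at this
    rw [varExponent_of_lt hq]
    simp only [Finsupp.add_apply, Finsupp.single_apply, Fin.ext_iff] at this ⊢
    grind
  obtain ⟨c, rfl⟩ := exists_add_of_le hle
  obtain rfl : t = c + varExponent n q' := by
    refine add_right_cancel (b := varExponent n q) ?_
    rw [← hst]
    abel
  rw [add_comm, varX_mul_monomial, varX_mul_monomial, mul_smul, mul_smul, ← smul_sub]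
  refine Submodule.smul_mem _ _ ?_
  rw [← sub_sub_sub_cancel_right _ _ (varX n K 0 • cellVector n K L p 0)]
  exact sub_mem (path_relation hL hLn h) (path_relation hL hLn h')

/-- The exponents in `hst` are crossed because generators of the dual are complements: it expresses
that x^s/(x_i x_j) and x^t/(x_i' x_j') agree. -/
theorem pair_relation (hL : Antitone L) (hLn : ∀ i, L i ≤ n) {i j i' j' : ℕ} (hij : i ≤ j)
    (hj : j < L i) (hij' : i' ≤ j') (hj' : j' < L i') {s t : Fin n →₀ ℕ}
    (hst : s + cellExponent n (i', j') = t + cellExponent n (i, j)) :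
    monomial s (1 : K) • cellVector n K L i j - monomial t (1 : K) • cellVector n K L i' j' ∈
      LinearMap.range (edgeBoundary (varX n K) n L) := by
  have hjn := hLn i
  have hjn' := hLn i'
  have c1 : max i j < L (min i j) := by rwa [max_eq_right hij, min_eq_left hij]
  have c2 : max i' j' < L (min i' j') := by rwa [max_eq_right hij', min_eq_left hij']
  have c1' : max j i < L (min j i) := by rwa [max_comm, min_comm]
  have c2' : max j' i' < L (min j' i') := by rwa [max_comm, min_comm]
  simp only [cellExponent] at hst
  by_cases e1 : i = i'
  · subst e1
    refine shared_relation hL hLn (by omega) (by omega) c1 c2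
      (add_right_cancel (b := varExponent n i) ?_)
    convert hst using 1 <;> abel
  by_cases e2 : i = j'
  · subst e2
    rw [cellVector_comm i' i]
    refine shared_relation hL hLn (by omega) (by omega) c1 c2'
      (add_right_cancel (b := varExponent n i) ?_)
    convert hst using 1 <;> abel
  by_cases e3 : j = i'
  · subst e3
    rw [cellVector_comm i j]
    refine shared_relation hL hLn (by omega) (by omega) c1' c2
      (add_right_cancel (b := varExponent n j) ?_)
    convert hst using 1 <;> abel
  by_cases e4 : j = j'
  · subst e4
    rw [cellVector_comm i j, cellVector_comm i' j]
    refine shared_relation hL hLn (by omega) (by omega) c1' c2'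
      (add_right_cancel (b := varExponent n j) ?_)
    convert hst using 1 <;> abel
  -- With no common variable the two generators are coprime, so each divides the multiplier of its
  -- own cell. This covers diagonal cells, where the exponent is 2.
  have hle : varExponent n i + varExponent n j ≤ s := by
    intro k
    have := DFunLike.congr_fun hst k
    rw [varExponent_of_lt (show i < n by omega), varExponent_of_lt (show j < n by omega),
      varExponent_of_lt (show i' < n by omega), varExponent_of_lt (show j' < n by omega)] at this
    rw [varExponent_of_lt (show i < n by omega), varExponent_of_lt (show j < n by omega)]
    simp only [Finsupp.add_apply, Finsupp.single_apply, Fin.ext_iff] at this ⊢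
    grind
  obtain ⟨c, rfl⟩ := exists_add_of_le hle
  obtain rfl : t = c + varExponent n i' + varExponent n j' := by
    refine add_right_cancel (b := varExponent n i + varExponent n j) ?_
    rw [← hst]
    abel
  rw [add_comm, ← add_assoc]
  simp only [varX_mul_monomial, mul_assoc]
  rw [mul_smul (monomial c 1), mul_smul (monomial c 1), ← smul_sub]
  refine Submodule.smul_mem _ _ ?_
  rw [← sub_sub_sub_cancel_right _ _
    ((varX n K 0 * varX n K 0) • cellVector n K L 0 0)]
  exact sub_mem (base_relation hL hLn c1) (base_relation hL hLn c2)

end Cells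

end LcmDual

namespace LcmDual

/-! ### The resolution of the LCM-dual -/

section Resolution

variable {n : ℕ} {K : Type*} [Field K] {L : ℕ → ℕ}

theorem homogeneousOfDegree_extend {S : Finset (ℕ × ℕ)} {d : ℤ} {f : S → MvPolynomial (Fin n) K}
    (hf : ∀ p, HomogeneousOfDegree (f p) d) (i j : ℕ) :
    HomogeneousOfDegree (extend S i j f) d := by
  by_cases h : (i, j) ∈ S
  · rw [extend_of_mem h]
    exact hf _
  · rw [extend_of_notMem h]
    exact .zero d

theorem homogeneousOfDegree_single {A : Type*} [DecidableEq A] (a b : A) :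
    HomogeneousOfDegree ((Pi.single a 1 : A → MvPolynomial (Fin n) K) b) 0 := by
  rw [Pi.single_apply]
  split_ifs
  exacts [.one, .zero 0]

theorem degree_varExponent {i : ℕ} (hi : i < n) : (varExponent n i).degree = 1 := by
  rw [varExponent_of_lt hi, Finsupp.degree_single]

theorem degree_cellExponent {p : ℕ × ℕ} (hp : p ∈ cells n L) : (cellExponent n p).degree = 2 := by
  rw [cellExponent, map_add, degree_varExponent (lt_of_mem_cells hp).1,
    degree_varExponent (lt_of_mem_cells hp).2]

theorem homogeneousOfDegree_varX {i : ℕ} (hi : i < n) :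
    HomogeneousOfDegree (varX n K i) 1 := by
  simpa [varX, degree_varExponent hi] using HomogeneousOfDegree.monomial (varExponent n i) (1 : K)

theorem homogeneousOfDegree_edgeBoundary (k : cells n L) (l : rowEdges n L ⊕ colEdges n L) :
    HomogeneousOfDegree (edgeBoundary (varX n K) n L (Pi.single l 1) k) 1 := by
  have hk := lt_of_mem_cells k.2
  rw [edgeBoundary_apply]
  refine .add (.mul (d := 1) (e := 0) (homogeneousOfDegree_varX hk.2) (.sub ?_ ?_))
    (.mul (d := 1) (e := 0) (homogeneousOfDegree_varX hk.1) (.sub ?_ ?_)) <;>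
  exact homogeneousOfDegree_extend (fun p => homogeneousOfDegree_single l _) _ _

theorem homogeneousOfDegree_squareBoundary (k : rowEdges n L ⊕ colEdges n L) (l : squares n L) :
    HomogeneousOfDegree (squareBoundary (varX n K) n L (Pi.single l 1) k) 1 := by
  rcases k with k | k
  · have hk := lt_of_mem_cells (Finset.filter_subset _ _ k.2)
    rw [squareBoundary_apply_inl]
    refine .mul (d := 1) (e := 0) (homogeneousOfDegree_varX hk.1) (.sub ?_ ?_) <;>
    exact homogeneousOfDegree_extend (homogeneousOfDegree_single l) _ _
  · have hk := lt_of_mem_cells (Finset.filter_subset _ _ k.2)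
    rw [squareBoundary_apply_inr]
    refine .neg (.mul (d := 1) (e := 0) (homogeneousOfDegree_varX hk.2) (.sub ?_ ?_)) <;>
    exact homogeneousOfDegree_extend (homogeneousOfDegree_single l) _ _

/-- The map sending the basis vector of a cell to the complementary monomial. -/
noncomputable def cellMap (n : ℕ) (K : Type*) [Field K] (L : ℕ → ℕ) (M : Fin n →₀ ℕ) :
    (cells n L → MvPolynomial (Fin n) K) →ₗ[MvPolynomial (Fin n) K] MvPolynomial (Fin n) K :=
  Fintype.linearCombination _ fun p : cells n L => monomial (M - cellExponent n p.1) (1 : K)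

variable {M : Fin n →₀ ℕ}

theorem cellMap_apply (c : cells n L → MvPolynomial (Fin n) K) :
    cellMap n K L M c = ∑ p, c p * monomial (M - cellExponent n p.1) (1 : K) := by
  simp [cellMap, Fintype.linearCombination_apply]

theorem cellMap_single (p : cells n L) :
    cellMap n K L M (Pi.single p 1) = monomial (M - cellExponent n p.1) (1 : K) := by
  simp [cellMap, Fintype.linearCombination_apply_single]

theorem range_cellMap : LinearMap.range (cellMap n K L M) =
    Ideal.span ((fun p => monomial (M - cellExponent n p) (1 : K)) '' cells n L) := by
  rw [cellMap, Fintype.range_linearCombination, Set.image_eq_range]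
  rfl

/-- Multiplying by one variable of the cell restores it in the complement, so only the other
variable is remembered. Hence two cells with a common variable have a linear syzygy. -/
theorem cellMap_varX_smul (hM : ∀ p ∈ cells n L, cellExponent n p ≤ M) {p : ℕ × ℕ}
    (hp : p ∈ cells n L) (h : p.1 ≤ p.2) :
    cellMap n K L M (varX n K p.1 • cellVector n K L p.1 p.2) =
        monomial (M - varExponent n p.2) 1 ∧
      cellMap n K L M (varX n K p.2 • cellVector n K L p.1 p.2) =
        monomial (M - varExponent n p.1) 1 := by
  obtain ⟨c, rfl⟩ := exists_add_of_le (hM p hp)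
  rw [cellVector_eq_single ⟨p, hp⟩ h, map_smul, map_smul, cellMap_single, smul_eq_mul, smul_eq_mul,
    varX, varX, monomial_mul, monomial_mul, one_mul, add_tsub_cancel_left]
  constructor
  · congr 1
    rw [cellExponent, show varExponent n p.1 + varExponent n p.2 + c =
      varExponent n p.2 + (varExponent n p.1 + c) by abel, add_tsub_cancel_left]
  · congr 1
    rw [cellExponent, add_assoc, add_tsub_cancel_left]

theorem cellMap_comp_edgeBoundary (hL : Antitone L) (hLn : ∀ i, L i ≤ n)
    (hM : ∀ p ∈ cells n L, cellExponent n p ≤ M) :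
    cellMap n K L M ∘ₗ edgeBoundary (varX n K) n L = 0 := by
  refine (Pi.basisFun _ _).ext fun l => ?_
  rw [Pi.basisFun_apply, LinearMap.comp_apply, LinearMap.zero_apply]
  rcases l with ⟨⟨i, j⟩, hl⟩ | ⟨⟨i, j⟩, hl⟩
  · have h := (mem_rowEdges hLn).1 hl
    obtain ⟨j, rfl⟩ : ∃ k, j = k + 1 := ⟨j - 1, by omega⟩
    rw [← Sum.elim_single_zero, edgeBoundary_single_inl (by omega), map_sub,
      (cellMap_varX_smul hM (p := (i, j + 1)) ((mem_cells hLn).2 (by omega)) (by grind)).2,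
      (cellMap_varX_smul hM (p := (i, j)) ((mem_cells hLn).2 (by omega)) (by grind)).2, sub_self]
  · have h := (mem_colEdges hLn).1 hl
    obtain ⟨i, rfl⟩ : ∃ k, i = k + 1 := ⟨i - 1, by omega⟩
    have := hL (Nat.le_succ i)
    rw [← Sum.elim_zero_single, edgeBoundary_single_inr (by omega), map_sub,
      (cellMap_varX_smul hM (p := (i + 1, j)) ((mem_cells hLn).2 (by omega)) (by grind)).1,
      (cellMap_varX_smul hM (p := (i, j)) ((mem_cells hLn).2 (by grind)) (by grind)).1, sub_self]

theorem exact_edgeBoundary_cellMap (hL : Antitone L) (hLn : ∀ i, L i ≤ n)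
    (hM : ∀ p ∈ cells n L, cellExponent n p ≤ M) :
    Function.Exact (edgeBoundary (varX n K) n L) (cellMap n K L M) := by
  intro c
  constructor
  · intro hc
    rw [cellMap_apply] at hc
    refine mem_of_sum_mul_monomial_eq_zero _ (LinearMap.range (edgeBoundary (varX n K) n L))
      (fun a b s t hst => ?_) hc
    have ha := (mem_cells hLn).1 a.2
    have hb := (mem_cells hLn).1 b.2
    rw [← cellVector_eq_single a ha.1, ← cellVector_eq_single b hb.1]
    refine pair_relation hL hLn ha.1 ha.2 hb.1 hb.2 ?_
    have ea := tsub_add_cancel_of_le (hM a.1 a.2)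
    have eb := tsub_add_cancel_of_le (hM b.1 b.2)
    -- Truncated differences are replaced by exponents known only through `wa + cellExponent = M`,
    -- leaving additive identities.
    generalize M - cellExponent n a.1 = wa at ea hst
    generalize M - cellExponent n b.1 = wb at eb hst
    refine add_right_cancel (b := M) ?_
    calc s + cellExponent n b.1 + M = s + wa + cellExponent n a.1 + cellExponent n b.1 := by
          rw [← ea]
          abel
      _ = t + cellExponent n a.1 + M := by
          rw [hst, ← eb]
          abel
  · rintro ⟨f, rfl⟩
    exact LinearMap.congr_fun (cellMap_comp_edgeBoundary hL hLn hM) f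

theorem exists_resolution_of_cells (hL : Antitone L) (hLn : ∀ i, L i ≤ n)
    (hM : ∀ p ∈ cells n L, cellExponent n p ≤ M) (hdeg : M.degree ≠ 2) :
    ∃ F : MinimalGradedFreeResolution
        (Ideal.span ((fun p => monomial (M - cellExponent n p) (1 : K)) '' cells n L)),
      F.rank 1 = (cells n L).card ∧ F.rank 2 = (rowEdges n L).card + (colEdges n L).card ∧
        F.rank 3 = (squares n L).card := by
  have := exists_resolution (cellMap n K L M) (edgeBoundary (varX n K) n L)
    (squareBoundary (varX n K) n L) ((M.degree : ℤ) - 2)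
    (by rw [sub_ne_zero]; exact_mod_cast hdeg) range_cellMap
    (exact_edgeBoundary_cellMap hL hLn hM)
    (exact_squareBoundary_edgeBoundary hL hLn eq_zero_of_varX_mul_eq_zero exists_of_varX_mul_eq)
    (squareBoundary_injective hL hLn eq_zero_of_varX_mul_eq_zero)
    (fun k => ?_) homogeneousOfDegree_edgeBoundary homogeneousOfDegree_squareBoundary
  · simpa only [Fintype.card_sum, Fintype.card_coe] using this
  · rw [cellMap_single]
    convert HomogeneousOfDegree.monomial _ _ using 1
    have := congrArg Finsupp.degree (tsub_add_cancel_of_le (hM k.1 k.2))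
    rw [map_add, degree_cellExponent k.2] at this
    omega

end Resolution

/-! ### The strongly stable ideal and its LCM-dual -/

section Ideals

variable {n : ℕ} {K : Type*} [Field K] {L : ℕ → ℕ}

theorem cellExponent_injOn (hLn : ∀ i, L i ≤ n) : Set.InjOn (cellExponent n) (cells n L) := by
  rintro ⟨i, j⟩ hp ⟨i', j'⟩ hq h
  have h1 := lt_of_mem_cells hp
  have h2 := lt_of_mem_cells hq
  have h3 := (mem_cells hLn).1 hp
  have h4 := (mem_cells hLn).1 hq
  simp only [cellExponent] at h h1 h2
  rw [varExponent_of_lt h1.1, varExponent_of_lt h1.2, varExponent_of_lt h2.1,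
    varExponent_of_lt h2.2] at h
  have e1 := DFunLike.congr_fun h ⟨i, h1.1⟩
  have e2 := DFunLike.congr_fun h ⟨j, h1.2⟩
  simp only [Finsupp.add_apply, Finsupp.single_apply, Fin.ext_iff] at e1 e2
  grind

/-- Among monomials of equal degree, divisibility is equality. -/
theorem minExponents_span {U : Set (Fin n →₀ ℕ)} (d : ℕ) (hU : ∀ u ∈ U, u.degree = d) :
    minExponents (Ideal.span ((fun u => monomial u (1 : K)) '' U)) = U := by
  have hmem : ∀ v : Fin n →₀ ℕ, monomial v (1 : K) ∈
      Ideal.span ((fun u => monomial u (1 : K)) '' U) ↔ ∃ u ∈ U, u ≤ v := by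
    intro v
    classical
    rw [mem_ideal_span_monomial_image, support_monomial, if_neg one_ne_zero]
    simp
  have heq : ∀ u v : Fin n →₀ ℕ, u ≤ v → u.degree = v.degree → u = v := by
    intro u v huv hd
    obtain ⟨c, rfl⟩ := exists_add_of_le huv
    rw [map_add] at hd
    rw [(Finsupp.degree_eq_zero_iff c).1 (by omega), add_zero]
  ext v
  simp only [minExponents, Set.mem_ofPred_eq, hmem, minimal_iff]
  constructor
  · rintro ⟨⟨u, hu, huv⟩, hmin⟩
    rwa [hmin ⟨u, hu, le_rfl⟩ huv]
  · intro hv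
    refine ⟨⟨v, hv, le_rfl⟩, ?_⟩
    rintro w ⟨u, hu, huw⟩ hwv
    have := heq u v (huw.trans hwv) ((hU u hu).trans (hU v hv).symm)
    exact le_antisymm (this ▸ huw) hwv

/-- The least common multiple is never computed: the resolution needs only that every generator
divides it and that its degree is not 2, so that the dual is not the unit ideal. -/
theorem lcmDual_span_cells (hLn : ∀ i, L i ≤ n) (h0 : n ≤ L 0) (hn : 2 ≤ n) :
    ∃ M : Fin n →₀ ℕ, (∀ p ∈ cells n L, cellExponent n p ≤ M) ∧ M.degree ≠ 2 ∧
      lcmDual (Ideal.span ((fun u => monomial u (1 : K)) '' (cellExponent n '' cells n L))) =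
        Ideal.span ((fun p => monomial (M - cellExponent n p) (1 : K)) '' cells n L) := by
  set I := Ideal.span ((fun u => monomial u (1 : K)) '' (cellExponent n '' cells n L))
  have hmin : minExponents I = cellExponent n '' cells n L := by
    refine minExponents_span 2 ?_
    rintro _ ⟨p, hp, rfl⟩
    exact degree_cellExponent hp
  have hle : ∀ p ∈ cells n L, cellExponent n p ≤ lcmExponent I := fun p hp =>
    Finset.le_sup (f := id) ((minExponents_finite I).mem_toFinset.2
      (hmin ▸ Set.mem_image_of_mem _ hp))
  refine ⟨lcmExponent I, hle, fun hd => ?_, ?_⟩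
  -- In degree 2 every generator would equal the least common multiple, but x_0² and x_0 x_1 are
  -- distinct generators since `n ≥ 2`.
  · have heq : ∀ p ∈ cells n L, lcmExponent I = cellExponent n p := by
      intro p hp
      obtain ⟨c, hc⟩ := exists_add_of_le (hle p hp)
      have := congrArg Finsupp.degree hc
      rw [map_add, degree_cellExponent hp, hd] at this
      rw [hc, (Finsupp.degree_eq_zero_iff c).1 (by omega), add_zero]
    have c0 : (0, 0) ∈ cells n L := (mem_cells hLn).2 (by omega)
    have c1 : (0, 1) ∈ cells n L := (mem_cells hLn).2 (by omega)
    have := cellExponent_injOn hLn c0 c1 ((heq _ c0).symm.trans (heq _ c1))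
    simp at this
  · rw [lcmDual, hmin, Set.image_image]

variable {m : ℕ}

/-- The row lengths of a shape with `m` rows, extended by zero. -/
def rowLength (lam : Fin m → ℕ) (i : ℕ) : ℕ :=
  if h : i < m then lam ⟨i, h⟩ else 0

/-- With zero-based indices, `i < j + 1` and `j + 1 ≤ lam i` become `i ≤ j` and `j < L i`. -/
theorem stronglyStableIdeal_eq_span (hmn : m ≤ n) (lam : Fin m → ℕ)
    (hLn : ∀ i, rowLength lam i ≤ n) :
    stronglyStableIdeal K hmn lam =
      Ideal.span ((fun u => monomial u (1 : K)) '' (cellExponent n '' cells n (rowLength lam))) := by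
  rw [stronglyStableIdeal, genFerrersIdeal, Ideal.map_span]
  congr 1
  ext p
  simp only [Set.mem_image, Set.mem_ofPred_eq, Finset.mem_coe]
  have hmono : ∀ i j (hi : i < n) (hj : j < n), monomial (cellExponent n (i, j)) (1 : K) =
      X ⟨i, hi⟩ * X ⟨j, hj⟩ := by
    intro i j hi hj
    rw [← varX_of_lt hi, ← varX_of_lt hj, varX, varX, monomial_mul, one_mul]
    rfl
  constructor
  · rintro ⟨_, ⟨i, j, h1, h2, rfl⟩, rfl⟩
    refine ⟨_, ⟨(i, j), (mem_cells hLn).2 ⟨by omega, ?_⟩, rfl⟩, ?_⟩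
    · rw [rowLength, dif_pos i.2]
      exact h2
    · rw [hmono i j (i.2.trans_le hmn) j.2]
      simp [specializationMap]
      rfl
  · rintro ⟨_, ⟨⟨i, j⟩, h, rfl⟩, rfl⟩
    have hn := lt_of_mem_cells h
    rw [mem_cells hLn, rowLength] at h
    split_ifs at h with hi
    · refine ⟨_, ⟨⟨i, hi⟩, ⟨j, hn.2⟩, by simp; omega, by simp; omega, rfl⟩, ?_⟩
      rw [hmono i j hn.1 hn.2]
      simp [specializationMap]
    · omega

end Ideals

end LcmDual

namespace LcmDual

/-! ### Height and number of generators -/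

section Height

variable (n : ℕ) (K : Type*) [Field K]

/-- The prime ideal generated by the first `k` variables, as the kernel of the map that kills
them. -/
noncomputable def coordIdeal (k : ℕ) : Ideal (MvPolynomial (Fin n) K) :=
  RingHom.ker (aeval fun i : Fin n => if (i : ℕ) < k then 0 else X i :
    MvPolynomial (Fin n) K →ₐ[K] MvPolynomial (Fin n) K)

instance (k : ℕ) : (coordIdeal n K k).IsPrime :=
  RingHom.ker_isPrime _

variable {n K}

theorem X_mem_coordIdeal {k : ℕ} {i : Fin n} :
    (X i : MvPolynomial (Fin n) K) ∈ coordIdeal n K k ↔ (i : ℕ) < k := by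
  rw [coordIdeal, RingHom.mem_ker, aeval_X]
  split_ifs with h <;> simp [h]

theorem coordIdeal_le {k : ℕ} {Q : Ideal (MvPolynomial (Fin n) K)}
    (h : ∀ i : Fin n, (i : ℕ) < k → X i ∈ Q) : coordIdeal n K k ≤ Q := by
  intro p hp
  rw [coordIdeal, RingHom.mem_ker] at hp
  have key : (Ideal.Quotient.mkₐ K Q).comp
      (aeval fun i : Fin n => if (i : ℕ) < k then 0 else X i) = Ideal.Quotient.mkₐ K Q := by
    refine algHom_ext fun i => ?_
    rw [AlgHom.comp_apply, aeval_X]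
    split_ifs with hi
    · rw [map_zero]
      exact (Ideal.Quotient.eq_zero_iff_mem.2 (h i hi)).symm
    · rfl
  have := AlgHom.congr_fun key p
  rw [AlgHom.comp_apply] at this
  refine Ideal.Quotient.eq_zero_iff_mem.1 (this.symm.trans ?_)
  rw [hp, map_zero]

/-- Krull's height theorem bounds the height above by the number of variables; the strict chain of
coordinate primes bounds it below. -/
theorem height_coordIdeal {k : ℕ} (hk : k ≤ n) : (coordIdeal n K k).height = k := by
  classical
  refine le_antisymm ?_ ?_
  · let s : Finset (MvPolynomial (Fin n) K) :=
      (Finset.univ.filter fun i : Fin n => (i : ℕ) < k).image X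
    have hs : coordIdeal n K k ∈ (Ideal.span (s : Set (MvPolynomial (Fin n) K))).minimalPrimes := by
      refine ⟨⟨inferInstance, Ideal.span_le.2 ?_⟩, fun Q hQ _ => coordIdeal_le fun i hi => ?_⟩
      · intro p hp
        obtain ⟨i, hi, rfl⟩ := Finset.mem_image.1 hp
        exact X_mem_coordIdeal.2 (Finset.mem_filter.1 hi).2
      · exact hQ.2 (Ideal.subset_span (Finset.mem_image_of_mem _ (by simpa using hi)))
    refine (Ideal.height_le_card_of_mem_minimalPrimes_span_finset hs).trans ?_
    have : (Finset.univ.filter fun i : Fin n => (i : ℕ) < k).card ≤ k := by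
      have h := Finset.card_le_card_of_injOn (s := Finset.univ.filter fun i : Fin n => (i : ℕ) < k)
        (t := Finset.range k) (fun i => (i : ℕ)) (by intro i; simp) Fin.val_injective.injOn
      simpa using h
    exact_mod_cast Finset.card_image_le.trans this
  · induction k with
    | zero => simp
    | succ k ih =>
      have hlt : coordIdeal n K k < coordIdeal n K (k + 1) := by
        refine lt_of_le_not_ge (coordIdeal_le fun i hi => X_mem_coordIdeal.2 (by omega)) fun h => ?_
        have := X_mem_coordIdeal.1 (h (X_mem_coordIdeal (i := ⟨k, hk⟩).2 (Nat.lt_succ_self k)))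
        exact lt_irrefl _ this
      push_cast
      exact (add_le_add_left (ih (by omega)) 1).trans
        (Ideal.height_add_one_le_of_lt_of_isPrime hlt)

/-- A prime over `I` contains the squares of the first `k` variables, hence the variables
themselves. -/
theorem height_eq_of_le_coordIdeal {k : ℕ} (hk : k ≤ n) {I : Ideal (MvPolynomial (Fin n) K)}
    (hI : I ≤ coordIdeal n K k) (h : ∀ i : Fin n, (i : ℕ) < k → X i * X i ∈ I) :
    I.height = k := by
  refine le_antisymm ((Ideal.height_mono hI).trans_eq (height_coordIdeal hk)) ?_
  rw [Ideal.height_eq_inf_minimalPrimes]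
  refine le_iInf₂ fun J hJ => ?_
  rw [← height_coordIdeal (K := K) hk]
  refine Ideal.height_mono (coordIdeal_le fun i hi => ?_)
  exact (or_self_iff.1 (hJ.1.1.mem_or_mem (hJ.1.2 (h i hi))))

end Height

section SpanFinrank

variable {σ K : Type*} [Field K]

theorem coeff_mul_of_degree_le {d : ℕ} {p q : MvPolynomial σ K}
    (hp : ∀ u ∈ p.support, d ≤ u.degree) {u : σ →₀ ℕ} (hu : u.degree = d) :
    coeff u (q * p) = constantCoeff q * coeff u p := by
  classical
  rw [coeff_mul, Finset.sum_eq_single (0, u)]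
  · rfl
  · rintro ⟨a, b⟩ hab hne
    replace hab : a + b = u := Finset.HasAntidiagonal.mem_antidiagonal.1 hab
    by_cases hb : b ∈ p.support
    · have h1 := hp b hb
      have h2 := congrArg Finsupp.degree hab
      rw [map_add] at h2
      have ha : a = 0 := (Finsupp.degree_eq_zero_iff a).1 (by omega)
      subst ha
      rw [zero_add] at hab
      exact (hne (by rw [← hab])).elim
    · rw [notMem_support_iff.1 hb, mul_zero]
  · simp

theorem spanFinrank_span_monomial (U : Finset (σ →₀ ℕ)) (d : ℕ) (hU : ∀ u ∈ U, u.degree = d) :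
    (Ideal.span ((fun u => monomial u (1 : K)) '' (U : Set (σ →₀ ℕ)))).spanFinrank = U.card := by
  classical
  set I := Ideal.span ((fun u => monomial u (1 : K)) '' (U : Set (σ →₀ ℕ)))
  have hfin := U.finite_toSet.image fun u => monomial u (1 : K)
  refine le_antisymm ?_ ?_
  · refine (Submodule.spanFinrank_span_le_ncard_of_finite hfin).trans ?_
    exact (Set.ncard_image_le U.finite_toSet).trans_eq (Set.ncard_coe_finset U)
  · obtain ⟨T, hT, hTI⟩ := (Submodule.fg_span hfin : I.FG).exists_span_finset_card_eq_spanFinrank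
    have hdeg : ∀ p ∈ I, ∀ u ∈ p.support, d ≤ u.degree := by
      intro p hp u hu
      obtain ⟨v, hv, hvu⟩ := mem_ideal_span_monomial_image.1 hp u hu
      rw [← hU v hv]
      exact Finsupp.degree_mono hvu
    -- On `I`, which has no terms below degree `d`, multiplication by `q` acts on these coefficients
    -- through its constant term. So `ρ` carries any generating set of `I` to a spanning set of `U →
    -- K`.
    let ρ : MvPolynomial σ K →ₗ[K] (U → K) := LinearMap.pi fun u => lcoeff K u.1
    have hρ : ∀ p ∈ I, ρ p ∈ Submodule.span K ((T.image ρ : Finset (U → K)) : Set (U → K)) := by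
      intro p hp
      have hle : ∀ p ∈ Submodule.span (MvPolynomial σ K) (T : Set (MvPolynomial σ K)),
          ρ p ∈ Submodule.span K ((T.image ρ : Finset (U → K)) : Set (U → K)) := by
        intro p hp
        induction hp using Submodule.span_induction with
        | mem p hp => exact Submodule.subset_span (Finset.mem_image_of_mem _ hp)
        | zero => rw [map_zero]; exact zero_mem _
        | add p q _ _ hp hq => rw [map_add]; exact add_mem hp hq
        | smul q p hp' hp =>
          have : ρ (q • p) = constantCoeff q • ρ p := by
            funext u
            exact coeff_mul_of_degree_le (hdeg p (hTI.le hp')) (hU u.1 u.2)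
          rw [this]
          exact Submodule.smul_mem _ _ hp
      exact hle p (hTI.ge hp)
    have htop : Submodule.span K ((T.image ρ : Finset (U → K)) : Set (U → K)) = ⊤ := by
      rw [eq_top_iff, ← (Pi.basisFun K U).span_eq, Submodule.span_le]
      rintro _ ⟨u, rfl⟩
      have hu := hρ (monomial u.1 1) (Ideal.subset_span (Set.mem_image_of_mem _ u.2))
      have e : ρ (monomial u.1 1) = Pi.basisFun K U u := by
        funext v
        change coeff v.1 (monomial u.1 1) = _
        rw [coeff_monomial, Pi.basisFun_apply, Pi.single_apply]
        simp only [Subtype.ext_iff, eq_comm]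
      rwa [e] at hu
    have := finrank_span_finset_le_card (R := K) (T.image ρ)
    rw [Set.finrank, htop, finrank_top, Module.finrank_fintype_fun_eq_card, Fintype.card_coe] at this
    exact (this.trans Finset.card_image_le).trans_eq hT

end SpanFinrank

end LcmDual

namespace LcmDual

/-! ### Numbers of cells, edges and squares -/

section Counting

/-- Counts row by row; `hab` makes the truncated interval lengths genuine differences. -/
theorem card_eq_sum_of_mem_iff {S : Finset (ℕ × ℕ)} {t : Finset ℕ} {a b : ℕ → ℕ}
    (h : ∀ i j, (i, j) ∈ S ↔ i ∈ t ∧ a i ≤ j ∧ j < b i) (hab : ∀ i ∈ t, a i ≤ b i) :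
    (S.card : ℤ) = ∑ i ∈ t, ((b i : ℤ) - a i) := by
  have : S.card = (t.sigma fun i => Finset.Ico (a i) (b i)).card :=
    Finset.card_nbij' (fun p => ⟨p.1, p.2⟩) (fun p => (p.1, p.2)) (by rintro ⟨i, j⟩; simp [h])
      (by rintro ⟨i, j⟩; simp [h]) (fun _ _ => rfl) (fun _ _ => rfl)
  rw [this, Finset.card_sigma, Nat.cast_sum]
  refine Finset.sum_congr rfl fun i hi => ?_
  rw [Nat.card_Ico, Nat.cast_sub (hab i hi)]

theorem sum_range_cast_eq_choose (m : ℕ) : ∑ i ∈ Finset.range m, (i : ℤ) = (m.choose 2 : ℤ) := by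
  induction m with
  | zero => rfl
  | succ m ih =>
    rw [Finset.sum_range_succ, ih, Nat.choose_succ_succ, Nat.choose_one_right]
    push_cast
    ring

variable {m n : ℕ} {L : ℕ → ℕ}

theorem card_cells (hLn : ∀ i, L i ≤ n) (hm : ∀ i, i < m → m ≤ L i) (h0 : ∀ i, m ≤ i → L i = 0) :
    ((cells n L).card : ℤ) = ∑ i ∈ Finset.range m, (L i : ℤ) - m.choose 2 := by
  rw [card_eq_sum_of_mem_iff (t := Finset.range m) (a := fun i => i) (b := L),
    Finset.sum_sub_distrib, sum_range_cast_eq_choose]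
  · intro i j
    have := h0 i
    rw [mem_cells hLn, Finset.mem_range]
    omega
  · intro i hi
    have := hm i (Finset.mem_range.1 hi)
    rw [Finset.mem_range] at hi
    omega

theorem card_rowEdges (hLn : ∀ i, L i ≤ n) (hm : ∀ i, i < m → m ≤ L i)
    (h0 : ∀ i, m ≤ i → L i = 0) :
    ((rowEdges n L).card : ℤ) = ∑ i ∈ Finset.range m, (L i : ℤ) - m.choose 2 - m := by
  rw [card_eq_sum_of_mem_iff (t := Finset.range m) (a := fun i => i + 1) (b := L)]
  · push_cast
    rw [Finset.sum_sub_distrib, Finset.sum_add_distrib, sum_range_cast_eq_choose]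
    simp
    ring
  · intro i j
    have := h0 i
    rw [mem_rowEdges hLn, Finset.mem_range]
    omega
  · intro i hi
    have := hm i (Finset.mem_range.1 hi)
    rw [Finset.mem_range] at hi
    omega

theorem card_colEdges (hLn : ∀ i, L i ≤ n) (hpos : 0 < m) (hm : ∀ i, i < m → m ≤ L i)
    (h0 : ∀ i, m ≤ i → L i = 0) :
    ((colEdges n L).card : ℤ) = ∑ i ∈ Finset.range m, (L i : ℤ) - L 0 - m.choose 2 := by
  -- Vertical edges are indexed by lower ends, so the top row is left out.
  rw [card_eq_sum_of_mem_iff (t := Finset.Ico 1 m) (a := fun i => i) (b := L)]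
  · have := Finset.sum_range_eq_add_Ico (fun i => (L i : ℤ) - i) hpos
    rw [Finset.sum_sub_distrib, sum_range_cast_eq_choose] at this
    push_cast at this
    linarith
  · intro i j
    have := h0 i
    rw [mem_colEdges hLn, Finset.mem_Ico]
    omega
  · intro i hi
    rw [Finset.mem_Ico] at hi
    have := hm i hi.2
    omega

theorem card_squares (hLn : ∀ i, L i ≤ n) (hpos : 0 < m) (hm : ∀ i, i < m → m ≤ L i)
    (h0 : ∀ i, m ≤ i → L i = 0) :
    ((squares n L).card : ℤ) =
      ∑ i ∈ Finset.range m, (L i : ℤ) - L 0 - m.choose 2 - m + 1 := by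
  rw [card_eq_sum_of_mem_iff (t := Finset.Ico 1 m) (a := fun i => i + 1) (b := L)]
  · have := Finset.sum_range_eq_add_Ico (fun i => (L i : ℤ) - (i + 1)) hpos
    rw [Finset.sum_sub_distrib, Finset.sum_add_distrib, sum_range_cast_eq_choose] at this
    push_cast at this ⊢
    simp only [Finset.sum_const, Finset.card_range, nsmul_eq_mul, mul_one] at this
    linarith
  · intro i j
    have := h0 i
    rw [mem_squares hLn, Finset.mem_Ico]
    omega
  · intro i hi
    rw [Finset.mem_Ico] at hi
    have := hm i hi.2
    omega

end Counting

theorem height_stronglyStableIdeal {K : Type*} [Field K] {m n : ℕ} (hmn : m ≤ n)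
    (lam : Fin m → ℕ) (hm : ∀ i, m ≤ lam i) : (stronglyStableIdeal K hmn lam).height = m := by
  refine height_eq_of_le_coordIdeal hmn ?_ fun i hi => ?_
  · rw [stronglyStableIdeal, genFerrersIdeal, Ideal.map_span, Ideal.span_le]
    rintro _ ⟨_, ⟨i, j, -, -, rfl⟩, rfl⟩
    rw [map_mul]
    refine Ideal.mul_mem_right _ _ ?_
    simpa [specializationMap] using (X_mem_coordIdeal (K := K) (i := Fin.castLE hmn i)).2 i.2
  · have h : X (Sum.inl ⟨i, hi⟩) * X (Sum.inr i) ∈ genFerrersIdeal K n lam (fun i => (i : ℕ)) :=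
      Ideal.subset_span ⟨⟨i, hi⟩, i, by simp, by have := hm ⟨i, hi⟩; omega, rfl⟩
    simpa [stronglyStableIdeal, specializationMap] using
      Ideal.mem_map_of_mem (specializationMap (K := K) hmn) h

end LcmDual

/-! ### Betti numbers, height and generator count put together -/

theorem mainTheorem6 (K : Type*) [Field K] (m n : ℕ) (hm : 0 < m) (hmn : m ≤ n)
    (lam : Fin m → ℕ) (hlam : Antitone lam) (hfirst : lam ⟨0, hm⟩ = n)
    (hlast : m - 1 < lam ⟨m - 1, Nat.sub_lt hm Nat.one_pos⟩) (hn : 2 ≤ n) :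
    ∃ β : ℕ → ℕ,
      LcmDual.AreBettiNumbers (LcmDual.lcmDual (LcmDual.stronglyStableIdeal K hmn lam)) β ∧
      ((β 1 : ℤ) = (∑ i, (lam i : ℤ)) - (m.choose 2 : ℤ) ∧
        (β 2 : ℤ) = (lam ⟨0, hm⟩ : ℤ)
          + 2 * (∑ i ∈ Finset.univ.erase (⟨0, hm⟩ : Fin m), (lam i : ℤ)) - (m : ℤ) ^ 2 ∧
        (β 3 : ℤ) = (∑ i ∈ Finset.univ.erase (⟨0, hm⟩ : Fin m), (lam i : ℤ))
          - ((m + 1).choose 2 : ℤ) + 1) ∧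
      ∃ g : ℕ, (LcmDual.stronglyStableIdeal K hmn lam).height = (g : ℕ∞) ∧
        β 1 = (LcmDual.stronglyStableIdeal K hmn lam).spanFinrank ∧
        (β 2 : ℤ) = 2 * ((LcmDual.stronglyStableIdeal K hmn lam).spanFinrank : ℤ) - g - n ∧
        (β 3 : ℤ) = ((LcmDual.stronglyStableIdeal K hmn lam).spanFinrank : ℤ) - g - n + 1 := by
  classical
  have hge : ∀ i, m ≤ lam i := fun i => by
    have : lam ⟨m - 1, Nat.sub_lt hm Nat.one_pos⟩ ≤ lam i :=
      hlam (Fin.le_def.2 (by have := i.2; simp only; omega))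
    omega
  have hle : ∀ i, lam i ≤ n := fun i => hfirst ▸ hlam (Fin.le_def.2 (Nat.zero_le _))
  set L := LcmDual.rowLength lam
  have hLlt : ∀ i (h : i < m), L i = lam ⟨i, h⟩ := fun i h => dif_pos h
  have hLge : ∀ i, m ≤ i → L i = 0 := fun i h => dif_neg (by omega)
  have hLm : ∀ i, i < m → m ≤ L i := fun i h => hLlt i h ▸ hge _
  have hLn : ∀ i, L i ≤ n := fun i => by
    rcases lt_or_ge i m with h | h
    · exact hLlt i h ▸ hle _
    · rw [hLge i h]
      exact Nat.zero_le _
  have hL : Antitone L := fun i j hij => by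
    rcases lt_or_ge j m with h | h
    · rw [hLlt j h, hLlt i (by omega)]
      exact hlam (Fin.le_def.2 hij)
    · rw [hLge j h]
      exact Nat.zero_le _
  have hL0 : L 0 = n := (hLlt 0 hm).trans hfirst
  have hI := LcmDual.stronglyStableIdeal_eq_span (K := K) hmn lam hLn
  obtain ⟨M, hM, hdeg, hdual⟩ := LcmDual.lcmDual_span_cells (K := K) hLn hL0.ge hn
  have hres := LcmDual.exists_resolution_of_cells (K := K) hL hLn hM hdeg
  rw [← hdual, ← hI] at hres
  obtain ⟨F, h1, h2, h3⟩ := hres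
  have hrank : (LcmDual.stronglyStableIdeal K hmn lam).spanFinrank = (LcmDual.cells n L).card := by
    rw [hI, ← Finset.coe_image, LcmDual.spanFinrank_span_monomial _ 2,
      Finset.card_image_of_injOn (LcmDual.cellExponent_injOn hLn)]
    intro u hu
    obtain ⟨p, hp, rfl⟩ := Finset.mem_image.1 hu
    exact LcmDual.degree_cellExponent hp
  have hsum : ∑ i, (lam i : ℤ) = ∑ i ∈ Finset.range m, (L i : ℤ) := by
    rw [Finset.sum_range]
    exact Finset.sum_congr rfl fun i _ => by rw [hLlt i i.2]
  have herase := Finset.add_sum_erase Finset.univ (fun i => (lam i : ℤ))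
    (Finset.mem_univ (⟨0, hm⟩ : Fin m))
  rw [hsum] at herase
  have hcells := LcmDual.card_cells hLn hLm hLge
  have hrow := LcmDual.card_rowEdges hLn hLm hLge
  have hcol := LcmDual.card_colEdges hLn hm hLm hLge
  have hsq := LcmDual.card_squares hLn hm hLm hLge
  have hchoose : ((m + 1).choose 2 : ℤ) = m.choose 2 + m := by
    rw [← LcmDual.sum_range_cast_eq_choose, ← LcmDual.sum_range_cast_eq_choose,
      Finset.sum_range_succ]
  have hsquare : 2 * (m.choose 2 : ℤ) + m = m ^ 2 := by
    have := Finset.sum_range_id_mul_two m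
    rw [← LcmDual.sum_range_cast_eq_choose]
    zify [hm] at this
    linear_combination this
  simp only [hfirst] at herase ⊢
  rw [hL0] at hcol hsq
  refine ⟨F.rank, ⟨⟨F⟩, fun G i => G.rank_eq_rank F i⟩, ⟨?_, ?_, ?_⟩, m,
    LcmDual.height_stronglyStableIdeal hmn lam hge, ?_, ?_, ?_⟩
  · rw [h1, hsum]
    linarith
  · rw [h2]
    push_cast
    linarith
  · rw [h3]
    linarith
  · rw [h1, hrank]
  · rw [h2, hrank]
    push_cast
    linarith
  · rw [h3, hrank]
    linarith
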